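/- All graphs are finite, undirected and loopless; parallel edges are allowed. A subgraph may be the null graph (no vertices). The line graph $L(G)$ has vertex set $E(G)$, two distinct edges of $G$ being adjacent in $L(G)$ (by a single edge) if and only if they share an end in $G$. For a graph $G$ let $V_i(G)$ be the set of vertices of degree $i$ in $G$, and $O(G)$ the set of vertices of odd degree in $G$. A branch of $G$ is a nontrivial path of $G$ (with distinct ends) whose two ends do not have degree $2$ in $G$ and whose internal vertices, if any, have degree $2$ in $G$; $B(G)$ is the set of branches of $G$, and $B_1(G)$ is the set of branches containing a vertex of $V_1(G)$. For subgraphs $H_1,H_2$ of $G$, $d_G(H_1,H_2)=\min\{d_G(v_1,v_2): v_1\in V(H_1),\ v_2\in V(H_2)\}$. For an integer $k\ge 1$, let $EUP_k(G)$ be the set of subgraphs $H$ of $G$ such that - (I)$'$ $|O(H)|\le 2$; - (II) $V_0(H)\subseteq\bigcup_{i\ge 3}V_i(G)\subseteq V(H)$; - (III) $d_G(H_1,H-H_1)\le k-1$ for every subgraph $H_1$ of $H$ that is the union of some, but not all, of the components of $H$ (at least one), where $H-H_1$ is the union of the remaining components; - (IV) $|E(b)|\le k+1$ for every branch $b\in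 B(G)$ with $E(b)\cap E(H)=\emptyset$; - (V)$'$ $|E(b)|\le k$ for every branch $b\in B_1(G)$ with $E(b)\cap E(H)=\emptyset$. **Theorem.** Let $G$ be a connected graph and let $k\ge 1$ be an integer. Then $EUP_k(L(G))\neq\emptyset$ if and only if $EUP_{k+1}(G)\neq\emptyset$. -/

import Mathlib

open scoped Graph

namespace Graph

/-- The line graph of `G`: its vertices are the edges of `G`, and two distinct edges of `G` are
joined (by exactly one edge, labelled by the unordered pair) if and only if they share an end.
It has neither loops nor parallel edges, even if `G` has parallel edges. -/
def lineGraph {α β : Type*} (G : Graph α β) : Graph β (Sym2 β) where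
  vertexSet := E(G)
  IsLink p e f := p = s(e, f) ∧ e ≠ f ∧ ∃ x, G.Inc e x ∧ G.Inc f x
  isLink_symm := by
    rintro p -
    exact ⟨fun e f ⟨hp, hne, x, he, hf⟩ ↦ ⟨hp.trans Sym2.eq_swap, hne.symm, x, hf, he⟩⟩
  eq_or_eq_of_isLink_of_isLink := by
    rintro p a b c d ⟨rfl, -⟩ ⟨h, -⟩
    rcases Sym2.eq_iff.1 h with h | h
    · exact Or.inl h.1
    · exact Or.inr h.1
  left_mem_of_isLink := by
    rintro p e f ⟨-, -, x, he, -⟩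
    exact he.edge_mem

/-- The degree of a vertex: the number of edges incident with it.  (All graphs considered are
finite and loopless.) -/
noncomputable def vertexDegree {α β : Type*} (G : Graph α β) (x : α) : ℕ :=
  (G.incidenceSet x).ncard

/-- `V_i(G)`, the set of vertices of degree `i`. -/
def verticesOfDegree {α β : Type*} (G : Graph α β) (i : ℕ) : Set α :=
  {x | x ∈ V(G) ∧ G.vertexDegree x = i}

/-- `O(G)`, the set of vertices of odd degree. -/
def oddVertices {α β : Type*} (G : Graph α β) : Set α :=
  {x | x ∈ V(G) ∧ Odd (G.vertexDegree x)}

/-- `d_G(H₁, H₂)`, the minimum of the distances `d_G(v₁, v₂)` over the vertices `v₁` of `H₁` and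
`v₂` of `H₂` (infinite if there is no such pair). -/
noncomputable def subgraphDist {α β : Type*} (G H₁ H₂ : Graph α β) : ℕ∞ :=
  ⨅ (x : V(G)) (y : V(G)) (_ : (x : α) ∈ V(H₁)) (_ : (y : α) ∈ V(H₂)), G.toSimpleGraph.edist x y

/-- A nontrivial path of `G`: distinct vertices `vert 0, …, vert length`, with consecutive ones
joined by the edges `edge 0, …, edge (length - 1)`.  Values at larger indices are irrelevant. -/
structure NontrivialPath {α β : Type*} (G : Graph α β) where
  length : ℕ
  length_pos : 0 < length
  vert : ℕ → α
  edge : ℕ → β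
  isLink : ∀ i < length, G.IsLink (edge i) (vert i) (vert (i + 1))
  injOn : Set.InjOn vert (Set.Iic length)

namespace NontrivialPath

/-- `V(b)`. -/
def vertices {α β : Type*} {G : Graph α β} (b : G.NontrivialPath) : Set α :=
  b.vert '' Set.Iic b.length

/-- `E(b)`. -/
def edges {α β : Type*} {G : Graph α β} (b : G.NontrivialPath) : Set β :=
  b.edge '' Set.Iio b.length

/-- A branch of `G`: a nontrivial path whose two ends do not have degree `2` in `G` and whose
internal vertices, if any, have degree `2` in `G`. -/
def IsBranch {α β : Type*} {G : Graph α β} (b : G.NontrivialPath) : Prop :=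
  G.vertexDegree (b.vert 0) ≠ 2 ∧ G.vertexDegree (b.vert b.length) ≠ 2 ∧
    ∀ i, 0 < i → i < b.length → G.vertexDegree (b.vert i) = 2

/-- The branches in `B₁(G)`: those containing a vertex of degree `1` of `G`. -/
def IsPendantBranch {α β : Type*} {G : Graph α β} (b : G.NontrivialPath) : Prop :=
  b.IsBranch ∧ (b.vertices ∩ G.verticesOfDegree 1).Nonempty

end NontrivialPath

/-- `EUP_k(G)`, a set of subgraphs of `G`.  In the third condition `H₁` ranges over the unions of
components of `H` (closed subgraphs), other than the graph without vertices and `H` itself, and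
`H - H₁` is the union of the remaining components. -/
structure IsEUP {α β : Type*} (G : Graph α β) (k : ℕ) (H : Graph α β) : Prop where
  le : H ≤ G
  odd_le_two : H.oddVertices.encard ≤ 2
  isolated_subset : H.verticesOfDegree 0 ⊆ ⋃ i ≥ 3, G.verticesOfDegree i
  subset_vertexSet : (⋃ i ≥ 3, G.verticesOfDegree i) ⊆ V(H)
  dist_le : ∀ H₁ : Graph α β, H₁ ≤c H → V(H₁).Nonempty → V(H₁) ≠ V(H) →
    G.subgraphDist H₁ (H.deleteVerts V(H₁)) ≤ ((k - 1 : ℕ) : ℕ∞)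
  branch_le : ∀ b : G.NontrivialPath, b.IsBranch → Disjoint b.edges E(H) →
    b.edges.encard ≤ ((k + 1 : ℕ) : ℕ∞)
  pendant_le : ∀ b : G.NontrivialPath, b.IsPendantBranch → Disjoint b.edges E(H) →
    b.edges.encard ≤ (k : ℕ∞)

/-- The set `EUP_k(G)`. -/
def EUP {α β : Type*} (G : Graph α β) (k : ℕ) : Set (Graph α β) :=
  {H | G.IsEUP k H}

end Graph

/-! An edge of the line graph is a pair of edges of `G` with a common end, so a subgraph of the line
graph is essentially a set of pairs, and its degrees are given by `pairDegree`. Passing to the line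
graph shortens long branches, and distances between different vertices, by one; this accounts for
the shift from `k + 1` to `k`. What remains is to transfer parity and connectivity.

From the line graph to `G` (`IsEUP.exists_of_lineGraph`): label every pair of `H'` with a common
end. Keep an edge of `G` if, for one of its ends `v`, it lies in an odd number of pairs labelled
`v`, and add all vertices of degree at least three. By the handshaking lemma an even number of edges
is odd at `v`. So `v` can have odd degree only if some edge at `v` is kept solely because of its
other end. Such an edge has odd degree in `H'`, and different vertices `v` yield different edges.

From `G` to the line graph (`IsEUP.exists_lineGraph`): take `H` with maximal edge set. The set of
edges of `H` at a vertex is made even by changing one edge if the vertex is odd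
(`IsEUP.exists_even_set`), and is then split into pairs; only the changed edges, at most two, get
odd degree. Toggling triangles of pairs preserves parities, and a largest set of pairs so obtained
connects all edges of `G` at each vertex of `H` (`IsEUP.exists_connecting_pairs`). A branch of the
line graph with at least two edges that avoids these pairs passes through vertices of degree two
outside `H`. It comes from a branch of `G` with one more edge, unless it closes up to a cycle; that
cycle could be added to `H` (`IsEUP.add_cycle`), against maximality. -/

namespace Graph

/-! ### Finite sets of unordered pairs -/

section Pairs

variable {β : Type*}

open Classical in
/-- The number of pairs of `P` containing `e`. -/
noncomputable def pairDegree (P : Finset (Sym2 β)) (e : β) : ℕ := (P.filter (e ∈ ·)).card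

lemma pairDegree_pos {P : Finset (Sym2 β)} {e : β} : 0 < pairDegree P e ↔ ∃ p ∈ P, e ∈ p := by
  simp [pairDegree, Finset.card_pos, Finset.Nonempty]

lemma pairDegree_singleton_of_mem {p : Sym2 β} {e : β} (h : e ∈ p) : pairDegree {p} e = 1 := by
  classical
  rw [pairDegree, Finset.card_eq_one]
  exact ⟨p, by ext q; simp +contextual [h]⟩

lemma pairDegree_singleton_of_notMem {p : Sym2 β} {e : β} (h : e ∉ p) :
    pairDegree {p} e = 0 := by
  by_contra h0
  obtain ⟨q, hq, he⟩ := pairDegree_pos.1 (Nat.pos_of_ne_zero h0)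
  exact h (Finset.mem_singleton.1 hq ▸ he)

lemma odd_card_symmDiff [DecidableEq β] (s t : Finset β) :
    Odd (symmDiff s t).card ↔ (Odd s.card ↔ ¬ Odd t.card) := by
  have h1 := Finset.card_sdiff_add_card_inter s t
  have h2 := Finset.card_sdiff_add_card_inter t s
  rw [Finset.inter_comm] at h2
  have h3 : (symmDiff s t).card = (s \ t).card + (t \ s).card := by
    rw [symmDiff_def, Finset.sup_eq_union, Finset.card_union_of_disjoint disjoint_sdiff_sdiff]
  rw [Nat.odd_iff, Nat.odd_iff, Nat.odd_iff]
  omega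

lemma odd_pairDegree_symmDiff [DecidableEq (Sym2 β)] (P Q : Finset (Sym2 β)) (e : β) :
    Odd (pairDegree (symmDiff P Q) e) ↔ (Odd (pairDegree P e) ↔ ¬ Odd (pairDegree Q e)) := by
  classical
  have : (symmDiff P Q).filter (e ∈ ·) = symmDiff (P.filter (e ∈ ·)) (Q.filter (e ∈ ·)) := by
    ext p
    simp only [Finset.mem_filter, Finset.mem_symmDiff]
    tauto
  rw [pairDegree, this]
  exact odd_card_symmDiff _ _

/-- The handshaking lemma. -/
lemma even_ncard_odd_pairDegree (P : Finset (Sym2 β)) (hP : ∀ p ∈ P, ¬ p.IsDiag) :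
    Even {e | Odd (pairDegree P e)}.ncard := by
  classical
  set A : Finset β := P.biUnion Sym2.toFinset with hA
  have hset : {e | Odd (pairDegree P e)} = ↑(A.filter fun e ↦ Odd (pairDegree P e)) := by
    ext e
    simp only [Set.mem_ofPred_eq, Finset.coe_filter, Set.mem_ofPred_eq, iff_and_self]
    intro h
    obtain ⟨p, hp, he⟩ := pairDegree_pos.1 h.pos
    exact Finset.mem_biUnion.2 ⟨p, hp, by simpa using he⟩
  rw [hset, Set.ncard_coe_finset, ← Finset.even_sum_iff_even_card_odd]
  have hswap : ∑ e ∈ A, pairDegree P e = ∑ p ∈ P, (A.filter (· ∈ p)).card := by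
    simp only [pairDegree, Finset.card_filter]
    rw [Finset.sum_comm]
  rw [hswap]
  refine Finset.even_sum _ fun p hp ↦ ?_
  have : A.filter (· ∈ p) = p.toFinset := by
    ext e
    simp only [Finset.mem_filter, Sym2.mem_toFinset, and_iff_right_iff_imp]
    exact fun he ↦ Finset.mem_biUnion.2 ⟨p, hp, by simpa using he⟩
  rw [this, Sym2.card_toFinset_of_not_isDiag _ (hP p hp)]
  exact even_two

/-- A finite set of even size is partitioned into pairs. -/
lemma exists_perfect_matching (A : Finset β) (hA : Even A.card) :
    ∃ M : Finset (Sym2 β), (∀ p ∈ M, ∃ e ∈ A, ∃ f ∈ A, e ≠ f ∧ p = s(e, f)) ∧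
      ∀ e, Odd (pairDegree M e) ↔ e ∈ A := by
  classical
  induction hn : A.card using Nat.strong_induction_on generalizing A with
  | _ n ih =>
  subst hn
  rcases A.eq_empty_or_nonempty with rfl | hne
  · exact ⟨∅, by simp, by simp [pairDegree]⟩
  have h1 : 1 < A.card := by
    have := hne.card_pos
    obtain ⟨r, hr⟩ := hA
    omega
  obtain ⟨e, he, f, hf, hef⟩ := Finset.one_lt_card.1 h1
  have hc : ((A.erase e).erase f).card + 2 = A.card := by
    rw [Finset.card_erase_of_mem (Finset.mem_erase.2 ⟨hef.symm, hf⟩),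
      Finset.card_erase_of_mem he]
    omega
  obtain ⟨M, hM, hodd⟩ := ih _ (by omega) ((A.erase e).erase f)
    (by rw [← hc] at hA; simpa [Nat.even_add] using hA) rfl
  refine ⟨symmDiff M {s(e, f)}, fun p hp ↦ ?_, fun x ↦ ?_⟩
  · rcases Finset.mem_symmDiff.1 hp with ⟨h, -⟩ | ⟨h, -⟩
    · obtain ⟨a, ha, b, hb, hab⟩ := hM p h
      exact ⟨a, Finset.mem_of_mem_erase (Finset.mem_of_mem_erase ha), b,
        Finset.mem_of_mem_erase (Finset.mem_of_mem_erase hb), hab⟩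
    · exact ⟨e, he, f, hf, hef, Finset.mem_singleton.1 h⟩
  · rw [odd_pairDegree_symmDiff, hodd]
    by_cases hx : x ∈ s(e, f)
    · rw [pairDegree_singleton_of_mem hx]
      rcases Sym2.mem_iff.1 hx with rfl | rfl <;> simp [he, hf]
    · rw [pairDegree_singleton_of_notMem hx]
      rw [Sym2.mem_iff, not_or] at hx
      simp [hx.1, hx.2]

/-- A set of pairs having as its odd elements those lying in an odd number of the sets `A v`, the
pairs being chosen within these sets. -/
lemma exists_pairs_of_even {α : Type*} (V : Finset α) (A : α → Finset β)
    (hA : ∀ v ∈ V, Even (A v).card) :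
    ∃ P : Finset (Sym2 β), (∀ p ∈ P, ∃ v ∈ V, ∃ e ∈ A v, ∃ f ∈ A v, e ≠ f ∧ p = s(e, f)) ∧
      (∀ e, Odd (pairDegree P e) ↔ Odd {v | v ∈ V ∧ e ∈ A v}.ncard) ∧
      ∀ v ∈ V, ∀ e f, e ≠ f → (∀ g, g ∈ A v ↔ g = e ∨ g = f) →
        (∀ u ∈ V, u ≠ v → ¬ (e ∈ A u ∧ f ∈ A u)) → s(e, f) ∈ P := by
  classical
  induction V using Finset.induction_on with
  | empty => exact ⟨∅, by simp, by simp [pairDegree], by simp⟩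
  | insert v V hv ih =>
  obtain ⟨P, hP, hodd, hforced⟩ := ih fun u hu ↦ hA u (Finset.mem_insert_of_mem hu)
  obtain ⟨M, hM, hModd⟩ := exists_perfect_matching (A v) (hA v (Finset.mem_insert_self ..))
  -- Two parallel edges may be paired at both of their common ends. The symmetric difference cancels
  -- the two copies, which leaves all parities correct.
  refine ⟨symmDiff P M, fun p hp ↦ ?_, fun e ↦ ?_, fun u hu e f hef hAu huniq ↦ ?_⟩
  · rcases Finset.mem_symmDiff.1 hp with ⟨h, -⟩ | ⟨h, -⟩
    · obtain ⟨u, hu, h⟩ := hP p h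
      exact ⟨u, Finset.mem_insert_of_mem hu, h⟩
    · exact ⟨v, Finset.mem_insert_self .., hM p h⟩
  · rw [odd_pairDegree_symmDiff, hModd, hodd]
    have hfin : {u | u ∈ V ∧ e ∈ A u}.Finite := V.finite_toSet.subset fun u hu ↦ hu.1
    by_cases he : e ∈ A v
    · have : {u | u ∈ insert v V ∧ e ∈ A u} = insert v {u | u ∈ V ∧ e ∈ A u} := by
        ext u
        simp only [Finset.mem_insert, Set.mem_ofPred_eq, Set.mem_insert_iff]
        constructor
        · tauto
        · rintro (rfl | h)
          · exact ⟨Or.inl rfl, he⟩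
          · exact ⟨Or.inr h.1, h.2⟩
      rw [this, Set.ncard_insert_of_notMem (fun h ↦ hv h.1) hfin, Nat.odd_add_one]
      simp [he]
    · have : {u | u ∈ insert v V ∧ e ∈ A u} = {u | u ∈ V ∧ e ∈ A u} := by
        ext u
        simp only [Finset.mem_insert, Set.mem_ofPred_eq]
        constructor
        · rintro ⟨rfl | h, h'⟩
          · exact absurd h' he
          · exact ⟨h, h'⟩
        · tauto
      rw [this]
      simp [he]
  · rw [Finset.mem_symmDiff]
    rcases Finset.mem_insert.1 hu with rfl | hu
    · right
      constructor
      · obtain ⟨p, hp, -⟩ := pairDegree_pos.1 ((hModd e).2 ((hAu e).2 (Or.inl rfl))).pos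
        obtain ⟨a, ha, b, hb, hab, rfl⟩ := hM p hp
        rw [hAu] at ha hb
        rcases ha with rfl | rfl <;> rcases hb with rfl | rfl
        · exact absurd rfl hab
        · exact hp
        · rwa [Sym2.eq_swap]
        · exact absurd rfl hab
      · intro h
        obtain ⟨w, hw, a, ha, b, hb, -, hp⟩ := hP _ h
        refine huniq w (Finset.mem_insert_of_mem hw) (fun h ↦ hv (h ▸ hw)) ?_
        rcases Sym2.eq_iff.1 hp with ⟨rfl, rfl⟩ | ⟨rfl, rfl⟩
        · exact ⟨ha, hb⟩
        · exact ⟨hb, ha⟩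
    · left
      refine ⟨hforced u hu e f hef hAu fun w hw ↦ huniq w (Finset.mem_insert_of_mem hw), ?_⟩
      intro h
      obtain ⟨a, ha, b, hb, -, hp⟩ := hM _ h
      refine huniq v (Finset.mem_insert_self ..) (fun h ↦ hv (h ▸ hu)) ?_
      rcases Sym2.eq_iff.1 hp with ⟨rfl, rfl⟩ | ⟨rfl, rfl⟩
      · exact ⟨ha, hb⟩
      · exact ⟨hb, ha⟩

/-- Among the sets of pairs with given parities, a largest one connects the corners of every
triangle of available pairs. -/
lemma exists_pairs_connecting_triangles (K P₀ : Finset (Sym2 β)) (F : Set (Sym2 β))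
    (hP₀ : P₀ ⊆ K) (hF : F ⊆ P₀) :
    ∃ P : Finset (Sym2 β), P ⊆ K ∧ F ⊆ P ∧
      (∀ e, Odd (pairDegree P e) ↔ Odd (pairDegree P₀ e)) ∧
      ∀ e f g, e ≠ f → e ≠ g → f ≠ g → s(e, f) ∈ (K : Set (Sym2 β)) \ F →
        s(e, g) ∈ (K : Set (Sym2 β)) \ F → s(f, g) ∈ (K : Set (Sym2 β)) \ F →
        ∀ U : Set β, (∀ x y, s(x, y) ∈ P → x ∈ U → y ∈ U) → e ∈ U → f ∈ U := by
  classical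
  let 𝓕 := K.powerset.filter fun P : Finset (Sym2 β) ↦ F ⊆ P ∧
    ∀ e, Odd (pairDegree P e) ↔ Odd (pairDegree P₀ e)
  obtain ⟨P, hP, hmax⟩ := Finset.exists_max_image 𝓕 Finset.card
    ⟨P₀, Finset.mem_filter.2 ⟨Finset.mem_powerset.2 hP₀, hF, fun _ ↦ Iff.rfl⟩⟩
  obtain ⟨hPK, hFP, hodd⟩ := Finset.mem_filter.1 hP
  rw [Finset.mem_powerset] at hPK
  refine ⟨P, hPK, hFP, hodd, fun e f g hef heg hfg h1 h2 h3 U hU he ↦ ?_⟩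
  by_contra hf
  have hU' : ∀ x y, s(x, y) ∈ P → (x ∈ U ↔ y ∈ U) := fun x y h ↦
    ⟨hU x y h, hU y x (by rwa [Sym2.eq_swap])⟩
  set D : Finset (Sym2 β) := {s(e, f), s(e, g), s(f, g)} with hD
  have hDcard : D.card = 3 := by
    rw [hD, Finset.card_eq_three]
    refine ⟨_, _, _, ?_, ?_, ?_, rfl⟩ <;> simp <;> tauto
  -- `U` separates `e` from `f`, and `g` is on one of the two sides. Only the pair inside that side
  -- can belong to `P`, so toggling the triangle gains at least one pair.
  have hinter : (P ∩ D).card ≤ 1 := by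
    rw [Finset.card_le_one]
    have key : ∀ p ∈ P ∩ D, p = if g ∈ U then s(e, g) else s(f, g) := by
      intro p hp
      obtain ⟨hpP, hpD⟩ := Finset.mem_inter.1 hp
      simp only [hD, Finset.mem_insert, Finset.mem_singleton] at hpD
      rcases hpD with rfl | rfl | rfl
      · exact absurd ((hU' _ _ hpP).1 he) hf
      · rw [if_pos ((hU' _ _ hpP).1 he)]
      · rw [if_neg (fun h ↦ hf ((hU' _ _ hpP).2 h))]
    intro p hp q hq
    rw [key p hp, key q hq]
  have hcard : P.card < (symmDiff P D).card := by
    have h1 := Finset.card_sdiff_add_card_inter P D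
    have h2 := Finset.card_sdiff_add_card_inter D P
    rw [Finset.inter_comm] at h2
    have h3 : (symmDiff P D).card = (P \ D).card + (D \ P).card := by
      rw [symmDiff_def, Finset.sup_eq_union, Finset.card_union_of_disjoint disjoint_sdiff_sdiff]
    omega
  refine absurd (hmax (symmDiff P D) (Finset.mem_filter.2 ⟨Finset.mem_powerset.2 ?_, ?_, ?_⟩))
    (by omega)
  · intro p hp
    rcases Finset.mem_symmDiff.1 hp with ⟨h, -⟩ | ⟨h, -⟩
    · exact hPK h
    · simp only [hD, Finset.mem_insert, Finset.mem_singleton] at h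
      rcases h with rfl | rfl | rfl
      exacts [h1.1, h2.1, h3.1]
  · intro p hp
    rw [Finset.mem_coe, Finset.mem_symmDiff]
    refine Or.inl ⟨hFP hp, fun h ↦ ?_⟩
    simp only [hD, Finset.mem_insert, Finset.mem_singleton] at h
    rcases h with rfl | rfl | rfl
    exacts [h1.2 hp, h2.2 hp, h3.2 hp]
  · intro x
    rw [odd_pairDegree_symmDiff, hodd]
    -- Each corner of the triangle lies in exactly two of its pairs, any other element in none.
    have hDx : Even (pairDegree D x) := by
      have hD3 : D = symmDiff {s(e, f)} (symmDiff {s(e, g)} {s(f, g)}) := by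
        ext p
        simp only [hD, Finset.mem_insert, Finset.mem_singleton, Finset.mem_symmDiff]
        have a1 : s(e, f) ≠ s(e, g) := by simp; tauto
        have a2 : s(e, f) ≠ s(f, g) := by simp; tauto
        have a3 : s(e, g) ≠ s(f, g) := by simp; tauto
        constructor
        · rintro (rfl | rfl | rfl) <;> tauto
        · tauto
      have hs : ∀ a b : β, Odd (pairDegree {s(a, b)} x) ↔ x = a ∨ x = b := by
        intro a b
        by_cases h : x ∈ s(a, b)
        · rw [pairDegree_singleton_of_mem h]
          simpa using Sym2.mem_iff.1 h
        · rw [pairDegree_singleton_of_notMem h]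
          simpa using fun h' ↦ h (Sym2.mem_iff.2 h')
      rw [← Nat.not_odd_iff_even, hD3, odd_pairDegree_symmDiff, odd_pairDegree_symmDiff, hs, hs,
        hs]
      by_cases hxe : x = e
      · subst hxe; simp [hef, heg]
      · by_cases hxf : x = f
        · subst hxf; simp [hef.symm, hfg]
        · simp [hxe, hxf]
    rw [← Nat.not_odd_iff_even] at hDx
    simp [hDx]

end Pairs

variable {α β : Type*} {G H : Graph α β} {k : ℕ}

/-! ### Subgraphs given by a set of vertices and a set of edges -/

/-- The subgraph of `G` with vertex set `X` and with the edges in `F` having both ends in `X`. -/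
def subgraphOf (G : Graph α β) (X : Set α) (F : Set β) : Graph α β := (G.induce X).restrict F

section subgraphOf

variable {X : Set α} {F : Set β}

lemma vertexSet_subgraphOf : V(G.subgraphOf X F) = X := rfl

lemma subgraphOf_le (hX : X ⊆ V(G)) : G.subgraphOf X F ≤ G :=
  restrict_le.trans (induce_le hX)

lemma subgraphOf_isLink (hF : ∀ e ∈ F, ∀ x, G.Inc e x → x ∈ X) {e : β} {x y : α} :
    (G.subgraphOf X F).IsLink e x y ↔ e ∈ F ∧ G.IsLink e x y := by
  simp only [subgraphOf, restrict_isLink, induce_isLink]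
  exact ⟨fun h ↦ ⟨h.1, h.2.1⟩,
    fun h ↦ ⟨h.1, h.2, hF e h.1 x h.2.inc_left, hF e h.1 y h.2.inc_right⟩⟩

lemma subgraphOf_inc (hF : ∀ e ∈ F, ∀ x, G.Inc e x → x ∈ X) {e : β} {x : α} :
    (G.subgraphOf X F).Inc e x ↔ e ∈ F ∧ G.Inc e x := by
  simp only [Inc, subgraphOf_isLink hF, exists_and_left]

lemma edgeSet_subgraphOf (hF : ∀ e ∈ F, ∀ x, G.Inc e x → x ∈ X) (hFE : F ⊆ E(G)) :
    E(G.subgraphOf X F) = F := by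
  ext e
  rw [edge_mem_iff_exists_isLink]
  simp only [subgraphOf_isLink hF]
  refine ⟨fun ⟨_, _, h⟩ ↦ h.1, fun h ↦ ?_⟩
  obtain ⟨x, y, hxy⟩ := exists_isLink_of_mem_edgeSet (hFE h)
  exact ⟨x, y, h, hxy⟩

end subgraphOf

/-! ### Degrees and incidences -/

lemma incidenceSet_finite (hE : E(G).Finite) (x : α) : (G.incidenceSet x).Finite :=
  hE.subset (incidenceSet_subset_edgeSet x)

lemma IsSubgraph.inc_iff (h : H ≤ G) {e : β} {x : α} : H.Inc e x ↔ e ∈ E(H) ∧ G.Inc e x :=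
  ⟨fun h' ↦ ⟨h'.edge_mem, h'.mono h⟩, fun h' ↦ (h.inc_congr h'.1).2 h'.2⟩

lemma vertexDegree_ne_zero_iff (hE : E(G).Finite) {x : α} :
    G.vertexDegree x ≠ 0 ↔ ∃ e, G.Inc e x := by
  rw [vertexDegree, ← Nat.pos_iff_ne_zero, Set.ncard_pos (incidenceSet_finite hE x)]
  rfl

lemma two_le_vertexDegree (hE : E(G).Finite) {x : α} {e f : β} (he : G.Inc e x) (hf : G.Inc f x)
    (hef : e ≠ f) : 2 ≤ G.vertexDegree x := by
  rw [vertexDegree, ← Set.ncard_pair hef]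
  refine Set.ncard_le_ncard ?_ (incidenceSet_finite hE x)
  rintro g (rfl | rfl)
  exacts [he, hf]

lemma three_le_vertexDegree (hE : E(G).Finite) {x : α} {e f g : β} (he : G.Inc e x)
    (hf : G.Inc f x) (hg : G.Inc g x) (hef : e ≠ f) (heg : e ≠ g) (hfg : f ≠ g) :
    3 ≤ G.vertexDegree x := by
  rw [vertexDegree]
  have : ({e, f, g} : Set β).ncard = 3 := by
    rw [Set.ncard_eq_three]; exact ⟨e, f, g, hef, heg, hfg, rfl⟩
  rw [← this]
  refine Set.ncard_le_ncard ?_ (incidenceSet_finite hE x)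
  rintro a (rfl | rfl | rfl)
  exacts [he, hf, hg]

lemma inc_iff_of_vertexDegree_eq_two (hE : E(G).Finite) {x : α} {e f : β}
    (hx : G.vertexDegree x = 2) (he : G.Inc e x) (hf : G.Inc f x) (hef : e ≠ f) {g : β} :
    G.Inc g x ↔ g = e ∨ g = f := by
  constructor
  · intro hg
    by_contra! h
    have := three_le_vertexDegree hE he hf hg hef h.1.symm h.2.symm
    omega
  · rintro (rfl | rfl)
    exacts [he, hf]

lemma vertexDegree_eq_two {x : α} {e f : β} (hef : e ≠ f)
    (h : ∀ g, G.Inc g x ↔ g = e ∨ g = f) : G.vertexDegree x = 2 := by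
  rw [vertexDegree, ← Set.ncard_pair hef]
  congr 1
  ext g
  exact h g

lemma isLink_of_inc_of_inc [G.Loopless] {e : β} {x y : α} (hx : G.Inc e x) (hy : G.Inc e y)
    (hxy : x ≠ y) : G.IsLink e x y := by
  obtain ⟨z, hz⟩ := hx
  obtain rfl := hy.eq_of_isLink_of_ne_left hz hxy.symm
  exact hz

lemma mem_iUnion_verticesOfDegree {x : α} :
    x ∈ ⋃ i ≥ 3, G.verticesOfDegree i ↔ x ∈ V(G) ∧ 3 ≤ G.vertexDegree x := by
  simp only [Set.mem_iUnion, verticesOfDegree, Set.mem_ofPred_eq]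
  constructor
  · rintro ⟨i, hi, hx, rfl⟩
    exact ⟨hx, hi⟩
  · rintro ⟨hx, hd⟩
    exact ⟨_, hd, hx, rfl⟩

/-! ### The line graph -/

lemma mem_edgeSet_lineGraph {p : Sym2 β} :
    p ∈ E(G.lineGraph) ↔ ∃ e f, p = s(e, f) ∧ e ≠ f ∧ ∃ x, G.Inc e x ∧ G.Inc f x := by
  rw [edge_mem_iff_exists_isLink]
  rfl

lemma mk_mem_edgeSet_lineGraph {e f : β} :
    s(e, f) ∈ E(G.lineGraph) ↔ e ≠ f ∧ ∃ x, G.Inc e x ∧ G.Inc f x := by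
  rw [mem_edgeSet_lineGraph]
  constructor
  · rintro ⟨a, b, hp, hab, x, ha, hb⟩
    rcases Sym2.eq_iff.1 hp with ⟨rfl, rfl⟩ | ⟨rfl, rfl⟩
    exacts [⟨hab, x, ha, hb⟩, ⟨hab.symm, x, hb, ha⟩]
  · exact fun h ↦ ⟨e, f, rfl, h⟩

lemma lineGraph_isLink_iff {p : Sym2 β} {e f : β} :
    G.lineGraph.IsLink p e f ↔ p = s(e, f) ∧ p ∈ E(G.lineGraph) := by
  refine ⟨fun h ↦ ⟨h.1, h.edge_mem⟩, ?_⟩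
  rintro ⟨rfl, h⟩
  exact ⟨rfl, mk_mem_edgeSet_lineGraph.1 h⟩

lemma lineGraph_inc_iff {p : Sym2 β} {e : β} :
    G.lineGraph.Inc p e ↔ p ∈ E(G.lineGraph) ∧ e ∈ p := by
  simp only [Inc, lineGraph_isLink_iff, Sym2.mem_iff_exists]
  constructor
  · rintro ⟨f, hp, h⟩
    exact ⟨h, f, hp⟩
  · rintro ⟨h, f, hp⟩
    exact ⟨f, hp, h⟩

lemma not_isDiag_of_mem_edgeSet_lineGraph {p : Sym2 β} (hp : p ∈ E(G.lineGraph)) :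
    ¬ p.IsDiag := by
  obtain ⟨e, f, rfl, hef, -⟩ := mem_edgeSet_lineGraph.1 hp
  exact hef

lemma edgeSet_lineGraph_finite (hE : E(G).Finite) : E(G.lineGraph).Finite := by
  refine ((hE.prod hE).image fun q : β × β ↦ s(q.1, q.2)).subset fun p hp ↦ ?_
  obtain ⟨e, f, rfl, -, x, he, hf⟩ := mem_edgeSet_lineGraph.1 hp
  exact ⟨(e, f), ⟨he.edge_mem, hf.edge_mem⟩, rfl⟩

/-- The edges of `G` other than `e` that share an end with `e`. -/
def lineNeighbors (G : Graph α β) (e : β) : Set β := {f | e ≠ f ∧ ∃ x, G.Inc e x ∧ G.Inc f x}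

lemma mem_lineNeighbors {e f : β} : f ∈ G.lineNeighbors e ↔ s(e, f) ∈ E(G.lineGraph) :=
  mk_mem_edgeSet_lineGraph.symm

lemma lineNeighbors_finite (hE : E(G).Finite) (e : β) : (G.lineNeighbors e).Finite :=
  hE.subset fun _ ⟨_, _, _, hf⟩ ↦ hf.edge_mem

lemma vertexDegree_lineGraph (e : β) :
    G.lineGraph.vertexDegree e = (G.lineNeighbors e).ncard := by
  have : G.lineGraph.incidenceSet e = (fun f ↦ s(e, f)) '' G.lineNeighbors e := by
    ext p
    rw [mem_incidenceSet, lineGraph_inc_iff, Set.mem_image]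
    constructor
    · rintro ⟨hp, he⟩
      obtain ⟨f, rfl⟩ := Sym2.mem_iff_exists.1 he
      exact ⟨f, mem_lineNeighbors.2 hp, rfl⟩
    · rintro ⟨f, hf, rfl⟩
      exact ⟨mem_lineNeighbors.1 hf, Sym2.mem_mk_left e f⟩
  rw [vertexDegree, this]
  exact Set.ncard_image_of_injective _ fun f g h ↦ Sym2.congr_right.1 h

/-- If the end `w` of `e` has degree two, then the degree of `e` in the line graph is the degree of
its other end. -/
lemma vertexDegree_lineGraph_eq (hE : E(G).Finite) {e f : β} {a w : α} (he : G.IsLink e a w)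
    (hf : ¬ G.Inc f a) (hw : ∀ g, G.Inc g w ↔ g = e ∨ g = f) :
    G.lineGraph.vertexDegree e = G.vertexDegree a := by
  have hef : e ≠ f := by rintro rfl; exact hf he.inc_left
  -- As `f` misses `a`, it is not counted twice: it replaces `e` in the count of the edges at `a`.
  have : G.lineNeighbors e = insert f (G.incidenceSet a \ {e}) := by
    ext g
    constructor
    · rintro ⟨hne, x, hx, hg⟩
      rcases hx.eq_or_eq_of_isLink he with rfl | rfl
      · exact Or.inr ⟨hg, hne.symm⟩
      · exact Or.inl (((hw g).1 hg).resolve_left hne.symm)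
    · rintro (rfl | ⟨hg, hne⟩)
      · exact ⟨hef, w, he.inc_right, (hw g).2 (Or.inr rfl)⟩
      · exact ⟨fun h ↦ hne h.symm, a, he.inc_left, hg⟩
  have hfin := incidenceSet_finite hE a
  rw [vertexDegree_lineGraph, this, Set.ncard_insert_of_notMem (fun h ↦ hf h.1) hfin.sdiff,
    Set.ncard_sdiff_singleton_add_one (show e ∈ G.incidenceSet a from he.inc_left) hfin,
    vertexDegree]

/-- An edge both of whose ends have degree at most two meets at most one other edge at each end. -/
lemma exists_three_le_vertexDegree (hE : E(G).Finite) {e : β} (he : e ∈ E(G))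
    (hd : 3 ≤ G.lineGraph.vertexDegree e) : ∃ x, G.Inc e x ∧ 3 ≤ G.vertexDegree x := by
  obtain ⟨x, y, hxy⟩ := exists_isLink_of_mem_edgeSet he
  by_contra! hc
  have hx := hc x hxy.inc_left
  have hy := hc y hxy.inc_right
  have hsub : G.lineNeighbors e ⊆ (G.incidenceSet x \ {e}) ∪ (G.incidenceSet y \ {e}) := by
    rintro g ⟨hne, z, hz, hg⟩
    rcases hz.eq_or_eq_of_isLink hxy with rfl | rfl
    · exact Or.inl ⟨hg, hne.symm⟩
    · exact Or.inr ⟨hg, hne.symm⟩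
  have hfx := incidenceSet_finite hE x
  have hfy := incidenceSet_finite hE y
  have h1 := Set.ncard_le_ncard hsub (hfx.sdiff.union hfy.sdiff)
  have h2 := Set.ncard_union_le (G.incidenceSet x \ {e}) (G.incidenceSet y \ {e})
  have h3 := Set.ncard_sdiff_singleton_add_one (show e ∈ G.incidenceSet x from hxy.inc_left) hfx
  have h4 := Set.ncard_sdiff_singleton_add_one (show e ∈ G.incidenceSet y from hxy.inc_right) hfy
  rw [vertexDegree_lineGraph] at hd
  rw [vertexDegree] at hx hy
  omega

/-! ### Distances -/

/-- The distance of the vertices `x` and `y` of `G` is at most `n`. -/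
def WithinDist (G : Graph α β) (n : ℕ) (x y : α) : Prop :=
  ∃ (hx : x ∈ V(G)) (hy : y ∈ V(G)) (w : G.toSimpleGraph.Walk ⟨x, hx⟩ ⟨y, hy⟩), w.length ≤ n

lemma subgraphDist_le_iff {H₁ H₂ : Graph α β} {n : ℕ} :
    G.subgraphDist H₁ H₂ ≤ n ↔ ∃ x ∈ V(H₁), ∃ y ∈ V(H₂), G.WithinDist n x y := by
  constructor
  · intro h
    -- The strict form of the bound yields a pair of vertices below it, without showing that the
    -- infimum is attained.
    have h' : G.subgraphDist H₁ H₂ < ((n + 1 : ℕ) : ℕ∞) :=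
      h.trans_lt (by exact_mod_cast Nat.lt_succ_self n)
    simp only [subgraphDist, iInf_lt_iff] at h'
    obtain ⟨x, y, hx, hy, hlt⟩ := h'
    obtain ⟨w, hw⟩ := SimpleGraph.exists_walk_of_edist_ne_top (ne_top_of_lt hlt)
    rw [← hw] at hlt
    exact ⟨x, hx, y, hy, x.2, y.2, w, Nat.lt_succ_iff.1 (by exact_mod_cast hlt)⟩
  · rintro ⟨x, hx, y, hy, hxG, hyG, w, hw⟩
    have hle : G.subgraphDist H₁ H₂ ≤ G.toSimpleGraph.edist ⟨x, hxG⟩ ⟨y, hyG⟩ := by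
      refine iInf₂_le_of_le (⟨x, hxG⟩ : V(G)) (⟨y, hyG⟩ : V(G)) ?_
      exact iInf₂_le_of_le hx hy le_rfl
    exact hle.trans ((SimpleGraph.edist_le w).trans (by exact_mod_cast hw))

lemma IsLink.withinDist_one {e : β} {x y : α} (h : G.IsLink e x y) : G.WithinDist 1 x y := by
  refine ⟨h.left_mem, h.right_mem, ?_⟩
  by_cases hxy : x = y
  · subst hxy
    exact ⟨.nil, by simp⟩
  · exact ⟨.cons ⟨fun h' ↦ hxy (congrArg Subtype.val h'), h.adj⟩ .nil, le_rfl⟩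

lemma WithinDist.mono {m n : ℕ} {x y : α} (h : G.WithinDist m x y) (hmn : m ≤ n) :
    G.WithinDist n x y := by
  obtain ⟨hx, hy, w, hw⟩ := h
  exact ⟨hx, hy, w, hw.trans hmn⟩

lemma WithinDist.trans {m n : ℕ} {x y z : α} (h : G.WithinDist m x y)
    (h' : G.WithinDist n y z) : G.WithinDist (m + n) x z := by
  obtain ⟨hx, hy, w, hw⟩ := h
  obtain ⟨_, hz, w', hw'⟩ := h'
  exact ⟨hx, hz, w.append w', by rw [SimpleGraph.Walk.length_append]; omega⟩

lemma withinDist_one_of_inc {e : β} {x y : α} (hx : G.Inc e x) (hy : G.Inc e y) :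
    G.WithinDist 1 x y := by
  by_cases hxy : x = y
  · subst hxy
    exact ⟨hx.vertex_mem, hx.vertex_mem, .nil, by simp⟩
  · obtain ⟨z, hz⟩ := hx
    obtain rfl := hy.eq_of_isLink_of_ne_left hz (Ne.symm hxy)
    exact hz.withinDist_one

/-- A walk of length `n` in the line graph visits `n + 1` edges of `G`; crossing each of them costs
at most one step. -/
lemma WithinDist.of_lineGraph {n : ℕ} {e f : β} (h : G.lineGraph.WithinDist n e f) {x y : α}
    (hx : G.Inc e x) (hy : G.Inc f y) : G.WithinDist (n + 1) x y := by
  obtain ⟨he, hf, w, hw⟩ := h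
  suffices ∀ (a b : V(G.lineGraph)) (w : G.lineGraph.toSimpleGraph.Walk a b) (x y : α),
      G.Inc a x → G.Inc b y → G.WithinDist (w.length + 1) x y from
    (this _ _ w x y hx hy).mono (by omega)
  intro a b w
  induction w with
  | nil => exact fun x y hx hy ↦ withinDist_one_of_inc hx hy
  | cons h w ih =>
    intro x y hx hy
    obtain ⟨p, -, -, z, hz, hz'⟩ := id h.2
    exact ((withinDist_one_of_inc hx hz).trans (ih z y hz' hy)).mono
      (by rw [SimpleGraph.Walk.length_cons]; omega)

/-- The edges traversed by a walk form a walk of the line graph with one step fewer. Since `x ≠ y`,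
at least one edge is traversed. -/
lemma WithinDist.exists_lineGraph {n : ℕ} {x y : α} (h : G.WithinDist (n + 1) x y)
    (hxy : x ≠ y) : ∃ e f, G.Inc e x ∧ G.Inc f y ∧ G.lineGraph.WithinDist n e f := by
  obtain ⟨hx, hy, w, hw⟩ := h
  suffices ∀ (a b : V(G)) (w : G.toSimpleGraph.Walk a b), a ≠ b →
      ∃ m e f, G.Inc e a ∧ G.Inc f b ∧ G.lineGraph.WithinDist m e f ∧ m + 1 ≤ w.length by
    obtain ⟨m, e, f, he, hf, hef, hm⟩ := this _ _ w fun h ↦ hxy (congrArg Subtype.val h)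
    exact ⟨e, f, he, hf, hef.mono (by omega)⟩
  intro a b w
  induction w with
  | nil => exact fun h ↦ absurd rfl h
  | @cons u v t h w ih =>
    intro _
    obtain ⟨e, he⟩ := id h.2
    rw [SimpleGraph.Walk.length_cons]
    by_cases hvt : v = t
    · subst hvt
      exact ⟨0, e, e, he.inc_left, he.inc_right, ⟨he.edge_mem, he.edge_mem, .nil, le_rfl⟩,
        by omega⟩
    · obtain ⟨m, e', f, he', hf, hd, hm⟩ := ih hvt
      -- The walk may turn back along the same edge, and then there is no step in the line graph.
      by_cases hee : e = e'
      · subst hee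
        exact ⟨m, e, f, he.inc_left, hf, hd, by omega⟩
      · have hl : G.lineGraph.IsLink s(e, e') e e' := ⟨rfl, hee, v, he.inc_right, he'⟩
        exact ⟨1 + m, e, f, he.inc_left, hf, hl.withinDist_one.trans hd, by omega⟩

/-! ### Connectedness -/

lemma vertexSet_subset_of_connected (hG : G.toSimpleGraph.Connected) {U : Set α} {x : α}
    (hxG : x ∈ V(G)) (hx : x ∈ U) (hU : ∀ e y z, G.IsLink e y z → y ∈ U → z ∈ U) :
    V(G) ⊆ U := by
  intro y hy
  obtain ⟨w⟩ := hG.preconnected ⟨x, hxG⟩ ⟨y, hy⟩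
  suffices ∀ (a b : V(G)) (_ : G.toSimpleGraph.Walk a b), (a : α) ∈ U → (b : α) ∈ U from
    this _ _ w hx
  intro a b w
  induction w with
  | nil => exact id
  | cons h w ih =>
    obtain ⟨e, he⟩ := id h.2
    exact fun ha ↦ ih (hU e _ _ he ha)

lemma edgeSet_subset_of_connected (hG : G.toSimpleGraph.Connected) {F : Set β} {e : β}
    (heG : e ∈ E(G)) (he : e ∈ F) (hF : ∀ f ∈ F, ∀ x, G.Inc f x → ∀ g, G.Inc g x → g ∈ F) :
    E(G) ⊆ F := by
  obtain ⟨x, y, hxy⟩ := exists_isLink_of_mem_edgeSet heG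
  have := vertexSet_subset_of_connected hG (U := {z | ∀ g, G.Inc g z → g ∈ F}) hxy.left_mem
    (fun g hg ↦ hF e he x hxy.inc_left g hg)
    (fun f a b hab ha g hg ↦ hF f (ha f hab.inc_left) b hab.inc_right g hg)
  intro g hg
  obtain ⟨a, b, hab⟩ := exists_isLink_of_mem_edgeSet hg
  exact this hab.left_mem g hab.inc_left

/-! ### Branches and the distance condition -/

lemma NontrivialPath.edge_injOn (b : G.NontrivialPath) : Set.InjOn b.edge (Set.Iio b.length) := by
  suffices ∀ i j, i < j → j < b.length → b.edge i ≠ b.edge j by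
    intro i hi j hj h
    rcases lt_trichotomy i j with hij | rfl | hij
    · exact absurd h (this i j hij hj)
    · rfl
    · exact absurd h.symm (this j i hij hi)
  intro i j hij hj h
  have h1 := b.isLink i (by omega)
  rw [h] at h1
  rcases h1.left_eq_or_eq (b.isLink j hj) with h2 | h2
  · have := b.injOn (Set.mem_Iic.2 (by omega)) (Set.mem_Iic.2 (by omega)) h2
    omega
  · have := b.injOn (Set.mem_Iic.2 (by omega)) (Set.mem_Iic.2 (by omega)) h2
    omega

lemma NontrivialPath.encard_edges (b : G.NontrivialPath) : b.edges.encard = (b.length : ℕ∞) := by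
  rw [NontrivialPath.edges, b.edge_injOn.encard_image, Set.encard_eq_coe_toFinset_card]
  simp

/-- The union of some components of `H` and the union of the remaining ones have distance at most
`n` in `G`. -/
def ComponentsWithinDist (G H : Graph α β) (n : ℕ) : Prop :=
  ∀ U ⊆ V(H), (∀ e x y, H.IsLink e x y → x ∈ U → y ∈ U) → U.Nonempty → U ≠ V(H) →
    ∃ x ∈ U, ∃ y ∈ V(H), y ∉ U ∧ G.WithinDist n x y

/-- Unions of components of `H` correspond to vertex sets closed under adjacency in `H`; the
subgraph belonging to `U` is `H.induce U`. -/
lemma componentsWithinDist_iff {n : ℕ} :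
    G.ComponentsWithinDist H n ↔ ∀ H₁ : Graph α β, H₁ ≤c H → V(H₁).Nonempty → V(H₁) ≠ V(H) →
      G.subgraphDist H₁ (H.deleteVerts V(H₁)) ≤ (n : ℕ∞) := by
  simp only [subgraphDist_le_iff, vertexSet_deleteVerts, Set.mem_sdiff, and_assoc]
  constructor
  · intro h H₁ hH₁ hne hne'
    exact h V(H₁) hH₁.le.vertexSet_mono
      (fun e x y he hx ↦ (hH₁.mem_iff_of_isLink he).1 hx) hne hne'
  · intro h U hUH hU hne hne'
    refine h (H.induce U) (IsClosedSubgraph.mk' (induce_le hUH) ?_) hne hne'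
    rintro e x ⟨y, hxy⟩ hx
    rw [edgeSet_induce]
    exact ⟨x, y, hxy, hx, hU e x y hxy hx⟩

lemma IsEUP.componentsWithinDist {k : ℕ} (h : G.IsEUP k H) : G.ComponentsWithinDist H (k - 1) :=
  componentsWithinDist_iff.2 h.dist_le

/-! ### The branch of the line graph given by a branch -/

namespace NontrivialPath

variable (b : G.NontrivialPath)

lemma vert_ne {i j : ℕ} (hi : i ≤ b.length) (hj : j ≤ b.length) (hij : i ≠ j) :
    b.vert i ≠ b.vert j :=
  fun h ↦ hij (b.injOn hi hj h)

lemma edge_ne {i j : ℕ} (hi : i < b.length) (hj : j < b.length) (hij : i ≠ j) :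
    b.edge i ≠ b.edge j :=
  fun h ↦ hij (b.edge_injOn hi hj h)

lemma not_inc_edge {i j : ℕ} (hi : i < b.length) (hj : j ≤ b.length) (hij : j ≠ i)
    (hij' : j ≠ i + 1) : ¬ G.Inc (b.edge i) (b.vert j) := fun h ↦
  (h.eq_or_eq_of_isLink (b.isLink i hi)).elim (b.vert_ne hj hi.le hij) (b.vert_ne hj hi hij')

/-- The path of the line graph formed by the edges of a path. -/
def toLineGraph (h : 2 ≤ b.length) : G.lineGraph.NontrivialPath where
  length := b.length - 1
  length_pos := by omega
  vert := b.edge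
  edge i := s(b.edge i, b.edge (i + 1))
  isLink i hi := ⟨rfl, b.edge_ne (by omega) (by omega) (by omega), b.vert (i + 1),
    (b.isLink i (by omega)).inc_right, (b.isLink (i + 1) (by omega)).inc_left⟩
  injOn := b.edge_injOn.mono fun i hi ↦ by
    rw [Set.mem_Iic] at hi
    rw [Set.mem_Iio]
    omega

variable {b}

lemma IsBranch.inc_vert_iff (hE : E(G).Finite) (hb : b.IsBranch) {i : ℕ}
    (hi : i + 1 < b.length) {g : β} :
    G.Inc g (b.vert (i + 1)) ↔ g = b.edge i ∨ g = b.edge (i + 1) :=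
  inc_iff_of_vertexDegree_eq_two hE (hb.2.2 (i + 1) (by omega) hi)
    (b.isLink i (by omega)).inc_right (b.isLink (i + 1) hi).inc_left
    (b.edge_ne (by omega) hi (by omega))

lemma IsBranch.vertexDegree_edge (hE : E(G).Finite) (hb : b.IsBranch) {i : ℕ}
    (hi : i + 1 < b.length) :
    G.lineGraph.vertexDegree (b.edge i) = G.vertexDegree (b.vert i) :=
  vertexDegree_lineGraph_eq hE (b.isLink i (by omega))
    (b.not_inc_edge hi (by omega) (by omega) (by omega)) fun _ ↦ hb.inc_vert_iff hE hi

/-- Here the degree-two end is the earlier one. This version is needed for the last edge of a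
branch, whose later end need not have degree two. -/
lemma IsBranch.vertexDegree_edge_succ (hE : E(G).Finite) (hb : b.IsBranch) {i : ℕ}
    (hi : i + 1 < b.length) :
    G.lineGraph.vertexDegree (b.edge (i + 1)) = G.vertexDegree (b.vert (i + 2)) :=
  vertexDegree_lineGraph_eq hE (b.isLink (i + 1) hi).symm
    (b.not_inc_edge (by omega) (by omega) (by omega) (by omega))
    fun _ ↦ (hb.inc_vert_iff hE hi).trans or_comm

lemma IsBranch.toLineGraph (hE : E(G).Finite) (hb : b.IsBranch) (h : 2 ≤ b.length) :
    (b.toLineGraph h).IsBranch := by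
  obtain ⟨m, hm⟩ : ∃ m, b.length = m + 2 := ⟨b.length - 2, by omega⟩
  have hlen : (b.toLineGraph h).length = m + 1 := by
    change b.length - 1 = _
    omega
  refine ⟨?_, ?_, fun i hi hi' ↦ ?_⟩
  · exact (hb.vertexDegree_edge hE (i := 0) (by omega)).trans_ne hb.1
  · rw [hlen]
    refine (hb.vertexDegree_edge_succ hE (i := m) (by omega)).trans_ne ?_
    rw [← hm]
    exact hb.2.1
  · rw [hlen] at hi'
    exact (hb.vertexDegree_edge hE (by omega)).trans (hb.2.2 i hi (by omega))

lemma IsPendantBranch.toLineGraph (hE : E(G).Finite) (hb : b.IsPendantBranch)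
    (h : 2 ≤ b.length) : (b.toLineGraph h).IsPendantBranch := by
  obtain ⟨hb, x, ⟨i, hi, rfl⟩, -, hdeg⟩ := hb
  rw [Set.mem_Iic] at hi
  obtain ⟨m, hm⟩ : ∃ m, b.length = m + 2 := ⟨b.length - 2, by omega⟩
  have hlen : (b.toLineGraph h).length = m + 1 := by
    change b.length - 1 = _
    omega
  refine ⟨hb.toLineGraph hE h, ?_⟩
  have key : ∀ j ≤ m + 1, G.lineGraph.vertexDegree (b.edge j) = 1 →
      ((b.toLineGraph h).vertices ∩ G.lineGraph.verticesOfDegree 1).Nonempty := fun j hj hd ↦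
    ⟨b.edge j, ⟨j, by rwa [hlen, Set.mem_Iic], rfl⟩, (b.isLink j (by omega)).edge_mem, hd⟩
  by_cases h0 : i = 0
  · subst h0
    exact key 0 (by omega) ((hb.vertexDegree_edge hE (by omega)).trans hdeg)
  · by_cases h1 : i = b.length
    · subst h1
      rw [hm] at hdeg
      exact key (m + 1) le_rfl ((hb.vertexDegree_edge_succ hE (by omega)).trans hdeg)
    · have := hb.2.2 i (by omega) (by omega)
      omega

end NontrivialPath

/-! ### From the line graph to the graph -/

section FromLineGraph

variable {H' : Graph β (Sym2 β)}

lemma inc_iff_of_le_lineGraph (h : H' ≤ G.lineGraph) {p : Sym2 β} {e : β} :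
    H'.Inc p e ↔ p ∈ E(H') ∧ e ∈ p := by
  rw [h.inc_iff, lineGraph_inc_iff]
  exact ⟨fun h ↦ ⟨h.1, h.2.2⟩, fun h' ↦ ⟨h'.1, h.edgeSet_mono h'.1, h'.2⟩⟩

lemma vertexDegree_eq_pairDegree (h : H' ≤ G.lineGraph) {P : Finset (Sym2 β)}
    (hP : E(H') = P) (e : β) : H'.vertexDegree e = pairDegree P e := by
  classical
  rw [vertexDegree, pairDegree, ← Set.ncard_coe_finset]
  congr 1
  ext p
  simp [inc_iff_of_le_lineGraph h, hP]

/-- Edges at `u` outside `H'` have degree at most two in the line graph. The other edges at `u`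
already use up this degree, so no edge of `G` misses `u` and `u` is adjacent to every other vertex.
-/
lemma withinDist_one_of_forall_notMem (hE : E(G).Finite) (hG : G.toSimpleGraph.Connected)
    (hH' : G.lineGraph.IsEUP k H') {u y : α} (hd : 3 ≤ G.vertexDegree u)
    (hu : ∀ e ∈ V(H'), ¬ G.Inc e u) (hy : y ∈ V(G)) (hyu : y ≠ u) : G.WithinDist 1 u y := by
  obtain ⟨e, he⟩ := (vertexDegree_ne_zero_iff hE (x := u)).1 (by omega)
  have hfin := incidenceSet_finite hE u
  have hclosed : E(G) ⊆ {f | G.Inc f u} := by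
    refine edgeSet_subset_of_connected hG he.edge_mem he fun f hf x hx g hg ↦ ?_
    by_contra hgu
    have hfg : f ≠ g := by rintro rfl; exact hgu hf
    have hlt : G.lineGraph.vertexDegree f < 3 := by
      by_contra! h3
      exact hu f (hH'.subset_vertexSet (mem_iUnion_verticesOfDegree.2 ⟨hf.edge_mem, h3⟩)) hf
    have hsub : insert g (G.incidenceSet u \ {f}) ⊆ G.lineNeighbors f := by
      rintro a (rfl | ⟨ha, ha'⟩)
      · exact ⟨hfg, x, hx, hg⟩
      · exact ⟨fun h ↦ ha' h.symm, u, hf, ha⟩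
    have h1 := Set.ncard_le_ncard hsub (lineNeighbors_finite hE f)
    rw [Set.ncard_insert_of_notMem (fun h ↦ hgu h.1) hfin.sdiff,
      Set.ncard_sdiff_singleton_add_one (show f ∈ G.incidenceSet u from hf) hfin] at h1
    rw [vertexDegree_lineGraph] at hlt
    rw [vertexDegree] at hd
    omega
  obtain ⟨w⟩ := hG.preconnected ⟨y, hy⟩ ⟨u, he.vertex_mem⟩
  cases w with
  | nil => exact absurd rfl hyu
  | cons h w =>
    obtain ⟨f, hf⟩ := id h.2
    exact withinDist_one_of_inc (hclosed hf.edge_mem) hf.inc_left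

theorem IsEUP.exists_of_lineGraph [G.Loopless] (hE : E(G).Finite)
    (hG : G.toSimpleGraph.Connected) (hk : 1 ≤ k) (hH' : G.lineGraph.IsEUP k H') :
    ∃ H, G.IsEUP (k + 1) H := by
  classical
  have hle := hH'.le
  have hfinP : E(H').Finite := (edgeSet_lineGraph_finite hE).subset hle.edgeSet_mono
  obtain ⟨P, hP⟩ : ∃ P : Finset (Sym2 β), E(H') = P := ⟨hfinP.toFinset, by simp⟩
  have hPL : ∀ p ∈ P, p ∈ E(G.lineGraph) := fun p hp ↦
    hle.edgeSet_mono (by rw [hP]; exact hp)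
  have hmemV : ∀ p ∈ P, ∀ e ∈ p, e ∈ V(H') := fun p hp e he ↦
    ((inc_iff_of_le_lineGraph hle).2 ⟨by rw [hP]; exact hp, he⟩).vertex_mem
  have hdeg : ∀ e, H'.vertexDegree e = pairDegree P e := vertexDegree_eq_pairDegree hle hP
  -- a common end of the two edges of each pair
  have hex : ∀ p ∈ P, ∃ v, ∀ e ∈ p, G.Inc e v := by
    intro p hp
    obtain ⟨e, f, rfl, -, x, he, hf⟩ := mem_edgeSet_lineGraph.1 (hPL p hp)
    refine ⟨x, fun g hg ↦ ?_⟩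
    rcases Sym2.mem_iff.1 hg with rfl | rfl
    exacts [he, hf]
  have hα : Nonempty α := ⟨(hG.nonempty.some : V(G))⟩
  have hex' : ∃ lab : Sym2 β → α, ∀ p ∈ P, ∀ e ∈ p, G.Inc e (lab p) := by
    choose! lab hlab using hex
    exact ⟨lab, hlab⟩
  obtain ⟨lab, hlab⟩ := hex'
  -- The label of a pair containing `e` is an end of `e`, so the degree of `e` in `P` is the sum of
  -- its degrees in `Q` at its two ends.
  let Q : α → Finset (Sym2 β) := fun v ↦ P.filter (lab · = v)
  have hQ : ∀ {v e}, Odd (pairDegree (Q v) e) → G.Inc e v ∧ e ∈ V(H') := by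
    intro v e h
    obtain ⟨p, hp, he⟩ := pairDegree_pos.1 h.pos
    obtain ⟨hp', hpv⟩ := Finset.mem_filter.1 hp
    exact ⟨hpv ▸ hlab p hp' e he, hmemV p hp' e he⟩
  have hsum : ∀ {e x y}, G.IsLink e x y →
      pairDegree P e = pairDegree (Q x) e + pairDegree (Q y) e := by
    intro e x y hxy
    rw [pairDegree, pairDegree, pairDegree, ← Finset.card_union_of_disjoint]
    · congr 1
      ext p
      simp only [Q, Finset.mem_filter, Finset.mem_union]
      constructor
      · rintro ⟨hp, he⟩
        rcases (hlab p hp e he).eq_or_eq_of_isLink hxy with h | h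
        · exact Or.inl ⟨⟨hp, h⟩, he⟩
        · exact Or.inr ⟨⟨hp, h⟩, he⟩
      · tauto
    · rw [Finset.disjoint_left]
      intro p hp hp'
      simp only [Q, Finset.mem_filter] at hp hp'
      exact hxy.ne (hp.1.2.symm.trans hp'.1.2)
  let F : Set β := {e | ∃ v, Odd (pairDegree (Q v) e)}
  have hFE : F ⊆ E(G) := fun e ⟨v, hv⟩ ↦ (hQ hv).1.edge_mem
  have hFV : ∀ e ∈ F, e ∈ V(H') := fun e ⟨v, hv⟩ ↦ (hQ hv).2
  let X : Set α := {x | ∃ e ∈ F, G.Inc e x} ∪ ⋃ i ≥ 3, G.verticesOfDegree i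
  have hFX : ∀ e ∈ F, ∀ x, G.Inc e x → x ∈ X := fun e he x hx ↦ Or.inl ⟨e, he, hx⟩
  have hXG : X ⊆ V(G) := by
    rintro x (⟨e, -, hx⟩ | hx)
    · exact hx.vertex_mem
    · exact (mem_iUnion_verticesOfDegree.1 hx).1
  have hHE : E(G.subgraphOf X F) = F := edgeSet_subgraphOf hFX hFE
  have hinc : ∀ {e x}, (G.subgraphOf X F).Inc e x ↔ e ∈ F ∧ G.Inc e x := subgraphOf_inc hFX
  have hFfin : F.Finite := hE.subset hFE
  -- two edges at a vertex of degree two forming a pair with that label lie in `F`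
  have hdegTwo : ∀ v e f, s(e, f) ∈ P → lab s(e, f) = v →
      (∀ g, G.Inc g v ↔ g = e ∨ g = f) → Odd (pairDegree (Q v) e) := by
    intro v e f hp hv hg
    have : Q v = {s(e, f)} := by
      ext q
      simp only [Q, Finset.mem_filter, Finset.mem_singleton]
      constructor
      · rintro ⟨hq, hqv⟩
        obtain ⟨a, c, rfl, hac, -⟩ := mem_edgeSet_lineGraph.1 (hPL q hq)
        have ha := (hg a).1 (hqv ▸ hlab _ hq a (Sym2.mem_mk_left ..))
        have hc := (hg c).1 (hqv ▸ hlab _ hq c (Sym2.mem_mk_right ..))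
        rcases ha with rfl | rfl <;> rcases hc with rfl | rfl
        · exact absurd rfl hac
        · rfl
        · exact Sym2.eq_swap
        · exact absurd rfl hac
      · rintro rfl
        exact ⟨hp, hv⟩
    rw [this, pairDegree_singleton_of_mem (Sym2.mem_mk_left ..)]
    exact odd_one
  -- At a label of degree two there is only one possible pair, so its members have degree one there
  -- and lie in `F`.
  have hlabX : ∀ p ∈ P, lab p ∈ X := by
    intro p hp
    obtain ⟨e, f, rfl, hef, -⟩ := mem_edgeSet_lineGraph.1 (hPL p hp)
    have he := hlab _ hp e (Sym2.mem_mk_left ..)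
    have hf := hlab _ hp f (Sym2.mem_mk_right ..)
    by_cases h3 : 3 ≤ G.vertexDegree (lab s(e, f))
    · exact Or.inr (mem_iUnion_verticesOfDegree.2 ⟨he.vertex_mem, h3⟩)
    · have h2 : G.vertexDegree (lab s(e, f)) = 2 := by
        have := two_le_vertexDegree hE he hf hef
        omega
      exact Or.inl ⟨e, ⟨_, hdegTwo _ e f hp rfl fun g ↦
        inc_iff_of_vertexDegree_eq_two hE h2 he hf hef⟩, he⟩
  have hendX : ∀ e ∈ V(H'), ∃ x ∈ X, G.Inc e x := by
    intro e he
    by_cases h0 : H'.vertexDegree e = 0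
    · have := hH'.isolated_subset ⟨he, h0⟩
      rw [mem_iUnion_verticesOfDegree] at this
      obtain ⟨x, hx, hd⟩ := exists_three_le_vertexDegree hE this.1 this.2
      exact ⟨x, Or.inr (mem_iUnion_verticesOfDegree.2 ⟨hx.vertex_mem, hd⟩), hx⟩
    · rw [hdeg] at h0
      obtain ⟨p, hp, hep⟩ := pairDegree_pos.1 (Nat.pos_of_ne_zero h0)
      exact ⟨lab p, hlabX p hp, hlab p hp e hep⟩
  have hbranch : ∀ (b : G.NontrivialPath) (hb : b.IsBranch) (h : 2 ≤ b.length),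
      Disjoint b.edges F → Disjoint (b.toLineGraph h).edges E(H') := by
    intro b hb h hdis
    rw [Set.disjoint_left]
    rintro _ ⟨i, hi, rfl⟩ hp
    have hi' : i + 1 < b.length := by
      have : i < b.length - 1 := hi
      omega
    replace hp : s(b.edge i, b.edge (i + 1)) ∈ P := by
      rw [hP] at hp
      exact hp
    have h1 := hlab _ hp _ (Sym2.mem_mk_left ..)
    have h2 := hlab _ hp _ (Sym2.mem_mk_right ..)
    have hv : lab s(b.edge i, b.edge (i + 1)) = b.vert (i + 1) := by
      rcases h1.eq_or_eq_of_isLink (b.isLink i (by omega)) with h | h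
      · rw [h] at h2
        exact absurd h2 (b.not_inc_edge hi' (by omega) (by omega) (by omega))
      · exact h
    exact Set.disjoint_left.1 hdis ⟨i, Set.mem_Iio.2 (by omega), rfl⟩
      ⟨_, hdegTwo _ _ _ hp hv fun _ ↦ hb.inc_vert_iff hE hi'⟩
  have hlen : ∀ (b : G.NontrivialPath) (h : 2 ≤ b.length),
      b.edges.encard = (b.toLineGraph h).edges.encard + 1 := by
    intro b h
    rw [NontrivialPath.encard_edges, NontrivialPath.encard_edges]
    change _ = ((b.length - 1 : ℕ) : ℕ∞) + 1
    norm_cast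
    omega
  refine ⟨G.subgraphOf X F, ⟨subgraphOf_le hXG, ?_, ?_, ?_, ?_, ?_, ?_⟩⟩
  · have key : ∀ v ∈ (G.subgraphOf X F).oddVertices,
        ∃ e ∈ H'.oddVertices, G.Inc e v ∧ Even (pairDegree (Q v) e) := by
      rintro v ⟨-, hv⟩
      by_contra! hc
      have hset : (G.subgraphOf X F).incidenceSet v = {e | Odd (pairDegree (Q v) e)} := by
        ext e
        rw [mem_incidenceSet, hinc, Set.mem_ofPred_eq]
        constructor
        · rintro ⟨⟨w, hw⟩, hev⟩
          by_contra hne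
          have hwv : v ≠ w := by rintro rfl; exact hne hw
          have hodd : Odd (H'.vertexDegree e) := by
            rw [hdeg, hsum (isLink_of_inc_of_inc hev (hQ hw).1 hwv)]
            exact (Nat.not_odd_iff_even.1 hne).add_odd hw
          exact hc e ⟨(hQ hw).2, hodd⟩ hev (Nat.not_odd_iff_even.1 hne)
        · exact fun h ↦ ⟨⟨v, h⟩, (hQ h).1⟩
      rw [vertexDegree, hset, ← Nat.not_even_iff_odd] at hv
      exact hv (even_ncard_odd_pairDegree _ fun p hp ↦
        not_isDiag_of_mem_edgeSet_lineGraph (hPL p (Finset.mem_filter.1 hp).1))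
    rcases Set.eq_empty_or_nonempty (G.subgraphOf X F).oddVertices with h0 | ⟨v₀, hv₀⟩
    · simp [h0]
    have hβ : Nonempty β := ⟨(key v₀ hv₀).choose⟩
    choose! c hc hcinc hceven using key
    -- An edge chosen for both of its ends would have degree even plus even in `H'`, yet it is odd
    -- there.
    have hinj : Set.InjOn c (G.subgraphOf X F).oddVertices := by
      intro u hu v hv huv
      by_contra hne
      have := (hc u hu).2
      have hcv := hcinc v hv
      have hev := hceven v hv
      rw [← huv] at hcv hev
      rw [hdeg, hsum (isLink_of_inc_of_inc (hcinc u hu) hcv hne), ← Nat.not_even_iff_odd] at this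
      exact this ((hceven u hu).add hev)
    rw [← hinj.encard_image]
    refine (Set.encard_le_encard ?_).trans hH'.odd_le_two
    rintro _ ⟨v, hv, rfl⟩
    exact hc v hv
  · rintro x ⟨hx, h0⟩
    rcases hx with ⟨e, he, hex⟩ | hx
    · exfalso
      exact (vertexDegree_ne_zero_iff (by rwa [hHE])).2 ⟨e, hinc.2 ⟨he, hex⟩⟩ h0
    · exact hx
  · exact Set.subset_union_right
  · rw [Nat.add_sub_cancel]
    refine componentsWithinDist_iff.1 ?_
    intro U hUX hU hne hne'
    rw [vertexSet_subgraphOf] at hUX hne' ⊢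
    -- An edge of `G` from `U` to the rest of `X` settles the claim at once. Otherwise any edge
    -- meeting `U` has all of its ends in `X` inside `U`.
    by_cases hcross : ∃ e x y, G.Inc e x ∧ G.Inc e y ∧ x ∈ U ∧ y ∈ X ∧ y ∉ U
    · obtain ⟨e, x, y, hx, hy, hxU, hyX, hyU⟩ := hcross
      exact ⟨x, hxU, y, hyX, hyU, (withinDist_one_of_inc hx hy).mono hk⟩
    push Not at hcross
    obtain ⟨u, hu⟩ := hne
    obtain ⟨y, hyX, hyU⟩ : ∃ y ∈ X, y ∉ U := by
      by_contra! hc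
      exact hne' (hUX.antisymm hc)
    have huy : u ≠ y := by rintro rfl; exact hyU hu
    have hd3 : ∀ x ∈ X, (∀ e ∈ V(H'), ¬ G.Inc e x) → 3 ≤ G.vertexDegree x := by
      rintro x (⟨e, he, hex⟩ | hx) hno
      · exact absurd hex (hno e (hFV e he))
      · exact (mem_iUnion_verticesOfDegree.1 hx).2
    by_cases hu0 : ∀ e ∈ V(H'), ¬ G.Inc e u
    · exact ⟨u, hu, y, hyX, hyU, (withinDist_one_of_forall_notMem hE hG hH' (hd3 u (hUX hu) hu0)
        hu0 (hXG hyX) huy.symm).mono hk⟩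
    by_cases hy0 : ∀ e ∈ V(H'), ¬ G.Inc e y
    · have := withinDist_one_of_forall_notMem hE hG hH' (hd3 y hyX hy0) hy0 (hXG (hUX hu)) huy
      obtain ⟨h1, h2, w, hw⟩ := this
      exact ⟨u, hu, y, hyX, hyU, h2, h1, w.reverse, by
        rw [SimpleGraph.Walk.length_reverse]; omega⟩
    push Not at hu0 hy0
    obtain ⟨eu, heu, heu'⟩ := hu0
    obtain ⟨ey, hey, hey'⟩ := hy0
    -- The vertices of `H'` with an end in `U` form a union of components of `H'`: the label of a
    -- pair joining two of its vertices lies in `X`, hence in `U` by `hcross`.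
    obtain ⟨e, ⟨-, x, hx, hex⟩, f, hf, hfS, hdist⟩ := hH'.componentsWithinDist
      {e | e ∈ V(H') ∧ ∃ x ∈ U, G.Inc e x} (fun e he ↦ he.1) (by
        rintro p e f hp ⟨-, x, hx, hex⟩
        refine ⟨hp.right_mem, ?_⟩
        have hpP : p ∈ P := by
          have := hp.edge_mem
          rwa [hP] at this
        have hpe := ((inc_iff_of_le_lineGraph hle).1 hp.inc_left).2
        have hpf := ((inc_iff_of_le_lineGraph hle).1 hp.inc_right).2
        exact ⟨lab p, hcross e x (lab p) hex (hlab p hpP e hpe) hx (hlabX p hpP),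
          hlab p hpP f hpf⟩) ⟨eu, heu, u, hu, heu'⟩ (fun h ↦ by
        obtain ⟨-, x, hx, hex⟩ : ey ∈ {e | e ∈ V(H') ∧ ∃ x ∈ U, G.Inc e x} := by
          rw [h]; exact hey
        exact hyU (hcross ey x y hex hey' hx hyX))
    obtain ⟨z, hz, hfz⟩ := hendX f hf
    have hzU : z ∉ U := fun h ↦ hfS ⟨hf, z, h, hfz⟩
    exact ⟨x, hx, z, hz, hzU, (hdist.of_lineGraph hex hfz).mono (by omega)⟩
  · intro b hb hdis
    rw [hHE] at hdis
    by_cases h : 2 ≤ b.length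
    · rw [hlen b h]
      have := hH'.branch_le _ (hb.toLineGraph hE h) (hbranch b hb h hdis)
      exact (add_le_add_left this 1).trans (by norm_cast)
    · rw [NontrivialPath.encard_edges]
      norm_cast
      omega
  · intro b hb hdis
    rw [hHE] at hdis
    by_cases h : 2 ≤ b.length
    · rw [hlen b h]
      have := hH'.pendant_le _ (hb.toLineGraph hE h) (hbranch b hb.1 h hdis)
      exact (add_le_add_left this 1).trans (by norm_cast)
    · rw [NontrivialPath.encard_edges]
      norm_cast
      omega

end FromLineGraph

/-! ### From the graph to the line graph -/

lemma vert_mem_vertexSet (b : G.NontrivialPath) {i : ℕ} (hi : i ≤ b.length) :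
    b.vert i ∈ V(G) := by
  rcases hi.lt_or_eq with h | rfl
  · exact (b.isLink i h).left_mem
  · have := b.length_pos
    have h := b.isLink (b.length - 1) (by omega)
    rw [Nat.sub_add_cancel this] at h
    exact h.right_mem

/-- A line graph on at most two vertices has no vertex of degree three and no path with two edges,
so the null graph meets all conditions. -/
lemma isEUP_bot_lineGraph (hE : E(G).Finite) (hcard : E(G).ncard ≤ 2) (hk : 1 ≤ k) :
    G.lineGraph.IsEUP k ⊥ := by
  have hlen : ∀ b : G.lineGraph.NontrivialPath, b.length ≤ 1 := by
    intro b
    by_contra! h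
    have h3 : ({b.vert 0, b.vert 1, b.vert 2} : Set β).ncard = 3 := by
      rw [Set.ncard_eq_three]
      exact ⟨_, _, _, b.vert_ne (by omega) (by omega) (by omega),
        b.vert_ne (by omega) (by omega) (by omega), b.vert_ne (by omega) (by omega) (by omega),
        rfl⟩
    have := Set.ncard_le_ncard (s := {b.vert 0, b.vert 1, b.vert 2}) (t := E(G)) (by
      rintro _ (rfl | rfl | rfl)
      exacts [vert_mem_vertexSet b (by omega), vert_mem_vertexSet b (by omega),
        vert_mem_vertexSet b (by omega)]) hE
    omega
  refine ⟨bot_le, ?_, ?_, ?_, ?_, fun b _ _ ↦ ?_, fun b _ _ ↦ ?_⟩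
  · have : (⊥ : Graph β (Sym2 β)).oddVertices = ∅ := by
      ext x
      simp [oddVertices]
    simp [this]
  · rintro x ⟨hx, -⟩
    simp at hx
  · intro e he
    rw [mem_iUnion_verticesOfDegree, vertexDegree_lineGraph] at he
    have := Set.ncard_le_ncard (s := G.lineNeighbors e) (t := E(G))
      (fun _ ⟨_, _, _, hf⟩ ↦ hf.edge_mem) hE
    omega
  · rintro H₁ hH₁ ⟨x, hx⟩
    simpa using hH₁.le.vertexSet_mono hx
  · rw [NontrivialPath.encard_edges]
    have := hlen b
    norm_cast
    omega
  · rw [NontrivialPath.encard_edges]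
    have := hlen b
    norm_cast
    omega

/-! ### Enlarging a subgraph by a cycle -/

/-- A cycle of `G` that passes through the vertex `a` of `H`, all of whose other vertices have
degree two in `G` and do not lie in `H`, may be added to `H`.  Here `X` is the set of the other
vertices and `F` the set of edges of the cycle. -/
lemma IsEUP.add_cycle (hE : E(G).Finite) (hH : G.IsEUP k H) {a : α} {X : Set α} {F : Set β}
    (ha : a ∈ V(H)) (hFE : F ⊆ E(G)) (hFH : Disjoint E(H) F)
    (hdeg : ∀ x ∈ X, x ∈ V(G) ∧ G.vertexDegree x = 2) (hXF : ∀ x ∈ X, G.incidenceSet x ⊆ F)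
    (hFX : ∀ e ∈ F, ∀ x, G.Inc e x → x = a ∨ x ∈ X)
    (heven : Even {e | e ∈ F ∧ G.Inc e a}.ncard)
    (hconn : ∀ U : Set α, (∀ e ∈ F, ∀ x y, G.IsLink e x y → x ∈ U → y ∈ U) →
      ∀ x ∈ X, x ∈ U ↔ a ∈ U) :
    G.IsEUP k (G.subgraphOf (V(H) ∪ X) (E(H) ∪ F)) := by
  have hle := hH.le
  have hends : ∀ e ∈ E(H) ∪ F, ∀ x, G.Inc e x → x ∈ V(H) ∪ X := by
    rintro e (he | he) x hx
    · exact Or.inl (hle.inc_iff.2 ⟨he, hx⟩).vertex_mem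
    · rcases hFX e he x hx with rfl | h
      exacts [Or.inl ha, Or.inr h]
  have hEE : E(H) ∪ F ⊆ E(G) := Set.union_subset hle.edgeSet_mono hFE
  have hE2 := edgeSet_subgraphOf hends hEE
  have hinc : ∀ {e x}, (G.subgraphOf (V(H) ∪ X) (E(H) ∪ F)).Inc e x ↔
      e ∈ E(H) ∪ F ∧ G.Inc e x := subgraphOf_inc hends
  have hdisj : ∀ b : G.NontrivialPath,
      Disjoint b.edges E(G.subgraphOf (V(H) ∪ X) (E(H) ∪ F)) → Disjoint b.edges E(H) := by
    intro b h
    rw [hE2] at h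
    exact h.mono_right Set.subset_union_left
  have hdegX : ∀ x ∈ X, (G.subgraphOf (V(H) ∪ X) (E(H) ∪ F)).vertexDegree x = 2 := by
    intro x hx
    rw [← (hdeg x hx).2, vertexDegree, vertexDegree]
    congr 1
    ext e
    rw [mem_incidenceSet, mem_incidenceSet, hinc]
    exact ⟨fun h ↦ h.2, fun h ↦ ⟨Or.inr (hXF x hx h), h⟩⟩
  refine ⟨subgraphOf_le (Set.union_subset hle.vertexSet_mono fun x hx ↦ (hdeg x hx).1), ?_, ?_, ?_,
    ?_, fun b hb h ↦ hH.branch_le b hb (hdisj b h), fun b hb h ↦ hH.pendant_le b hb (hdisj b h)⟩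
  · refine (Set.encard_le_encard ?_).trans hH.odd_le_two
    rintro x ⟨hx, hodd⟩
    have hxX : x ∉ X := fun h ↦ by
      rw [hdegX x h] at hodd
      exact absurd hodd (by decide)
    refine ⟨hx.resolve_right hxX, ?_⟩
    have hset : (G.subgraphOf (V(H) ∪ X) (E(H) ∪ F)).incidenceSet x =
        H.incidenceSet x ∪ {e | e ∈ F ∧ G.Inc e x} := by
      ext e
      simp only [mem_incidenceSet, hinc, Set.mem_union, hle.inc_iff, Set.mem_ofPred_eq]
      tauto
    have hEH : E(H).Finite := hE.subset hle.edgeSet_mono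
    rw [vertexDegree, hset, Set.ncard_union_eq (Set.disjoint_left.2 fun e he he' ↦
        Set.disjoint_left.1 hFH (incidenceSet_subset_edgeSet x he) he'.1)
      (incidenceSet_finite hEH x) (hE.subset fun e he ↦ hFE he.1), Nat.odd_add] at hodd
    refine hodd.2 ?_
    by_cases hxa : x = a
    · rwa [hxa]
    · have : {e | e ∈ F ∧ G.Inc e x} = ∅ := by
        ext e
        simp only [Set.mem_ofPred_eq, Set.mem_empty_iff_false, iff_false]
        rintro ⟨he, hex⟩
        exact (hFX e he x hex).elim hxa hxX
      simp [this]
  · rintro x ⟨hx, h0⟩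
    have hxX : x ∉ X := fun h ↦ by
      rw [hdegX x h] at h0
      omega
    refine hH.isolated_subset ⟨hx.resolve_right hxX, ?_⟩
    by_contra hne
    obtain ⟨e, he⟩ := (vertexDegree_ne_zero_iff (hE.subset hle.edgeSet_mono)).1 hne
    exact (vertexDegree_ne_zero_iff (by rw [hE2]; exact hE.subset hEE)).2
      ⟨e, hinc.2 ⟨Or.inl he.edge_mem, he.mono hle⟩⟩ h0
  · exact hH.subset_vertexSet.trans Set.subset_union_left
  · refine componentsWithinDist_iff.1 ?_
    intro U hUV hU hne hne'
    rw [vertexSet_subgraphOf] at hUV hne' ⊢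
    have hXa := hconn U fun e he x y hxy ↦
      hU e x y ((subgraphOf_isLink hends).2 ⟨Or.inr he, hxy⟩)
    -- The new vertices are on the same side of `U` as `a`, so restricting to `V(H)` keeps both
    -- sides nonempty.
    obtain ⟨x, hx, y, hy, hyU, hd⟩ := hH.componentsWithinDist (U ∩ V(H)) Set.inter_subset_right
      (fun e x y hxy hx ↦ ⟨hU e x y ((subgraphOf_isLink hends).2
        ⟨Or.inl hxy.edge_mem, hxy.mono hle⟩) hx.1, hxy.right_mem⟩)
      (by
        obtain ⟨x, hx⟩ := hne
        rcases hUV hx with h | h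
        · exact ⟨x, hx, h⟩
        · exact ⟨a, (hXa x h).1 hx, ha⟩)
      (fun h ↦ hne' (hUV.antisymm (by
        have h' : V(H) ⊆ U := Set.inter_eq_right.1 h
        exact Set.union_subset h' fun x hx ↦ (hXa x hx).2 (h' ha))))
    exact ⟨x, hx.1, y, Or.inl hy, fun h ↦ hyU ⟨h, hy⟩, hd⟩

/-! ### The pairs of edges chosen from a subgraph of the graph -/

/-- Even sets of edges at the vertices of `H`, close to the sets of edges of `H`. -/
lemma IsEUP.exists_even_set (hE : E(G).Finite) (hH : G.IsEUP k H) {v : α} (hv : v ∈ V(H)) :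
    ∃ (A : Finset β) (c : β), Even A.card ∧ (∀ e ∈ A, G.Inc e v) ∧
      (G.vertexDegree v = 2 → ∀ e, G.Inc e v → e ∈ A) ∧
      ∀ e, (v ∈ H.oddVertices → e ≠ c) → (e ∈ A ↔ H.Inc e v) := by
  classical
  have hle := hH.le
  have hEH : E(H).Finite := hE.subset hle.edgeSet_mono
  have hfin := incidenceSet_finite hEH v
  have hfinG := incidenceSet_finite hE v
  have hsub : H.incidenceSet v ⊆ G.incidenceSet v := fun e he ↦ Inc.mono hle he
  have hcard : hfin.toFinset.card = H.vertexDegree v := by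
    rw [vertexDegree, Set.ncard_eq_toFinset_card _ hfin]
  have hpos : H.vertexDegree v ≠ 0 ∨ 3 ≤ G.vertexDegree v := by
    by_contra! h
    have := (mem_iUnion_verticesOfDegree.1 (hH.isolated_subset ⟨hv, h.1⟩)).2
    omega
  have hne : H.vertexDegree v ≠ 0 ∨ G.vertexDegree v ≠ 0 := by omega
  have hGpos : G.vertexDegree v ≠ 0 := by
    rcases hne with h | h
    · obtain ⟨e, he⟩ := (vertexDegree_ne_zero_iff hEH).1 h
      exact (vertexDegree_ne_zero_iff hE).2 ⟨e, he.mono hle⟩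
    · exact h
  by_cases hodd : Odd (H.vertexDegree v)
  · have hmem : v ∈ H.oddVertices := ⟨hv, hodd⟩
    by_cases h2 : G.vertexDegree v = 2
    -- An odd vertex of degree two in `G` has degree one in `H`; adding the missing edge makes the
    -- set even and complete.
    · have hlt : (H.incidenceSet v).ncard < (G.incidenceSet v).ncard := by
        have h1 := Set.ncard_le_ncard hsub hfinG
        change H.vertexDegree v < G.vertexDegree v
        change H.vertexDegree v ≤ G.vertexDegree v at h1
        rcases h1.lt_or_eq with h | h
        · exact h
        · rw [h, h2] at hodd
          exact absurd hodd (by decide)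
      obtain ⟨c, hc, hcH⟩ := Set.exists_mem_notMem_of_ncard_lt_ncard hlt hfin
      have hcard' : (insert c hfin.toFinset).card = H.vertexDegree v + 1 := by
        rw [Finset.card_insert_of_notMem (by simpa using hcH), hcard]
      refine ⟨insert c hfin.toFinset, c, ?_, ?_, ?_, ?_⟩
      · rw [hcard']
        exact hodd.add_one
      · intro e he
        rcases Finset.mem_insert.1 he with rfl | he
        · exact hc
        · exact hsub (hfin.mem_toFinset.1 he)
      · intro _ e he
        have hss : insert c hfin.toFinset ⊆ hfinG.toFinset := by
          intro f hf
          rw [Set.Finite.mem_toFinset]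
          rcases Finset.mem_insert.1 hf with rfl | hf
          · exact hc
          · exact hsub (hfin.mem_toFinset.1 hf)
        have hG2 : hfinG.toFinset.card = 2 := by
          rw [← h2, vertexDegree, Set.ncard_eq_toFinset_card _ hfinG]
        have heq := Finset.eq_of_subset_of_card_le hss (by
          rw [hG2, hcard']
          have := hodd.pos
          omega)
        rw [heq, Set.Finite.mem_toFinset]
        exact he
      · intro e he
        simp [he hmem]
    -- At the remaining odd vertices one edge of `H` is dropped instead.
    · obtain ⟨c, hc⟩ := (vertexDegree_ne_zero_iff hEH).1 hodd.pos.ne'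
      refine ⟨hfin.toFinset.erase c, c, ?_, ?_, fun h ↦ absurd h h2, ?_⟩
      · rw [Finset.card_erase_of_mem (by simpa using hc), hcard]
        obtain ⟨r, hr⟩ := hodd
        exact ⟨r, by omega⟩
      · intro e he
        exact hsub (hfin.mem_toFinset.1 (Finset.mem_of_mem_erase he))
      · intro e he
        simp [he hmem]
  · obtain ⟨c, -⟩ := (vertexDegree_ne_zero_iff hE).1 hGpos
    refine ⟨hfin.toFinset, c, ?_, ?_, ?_, ?_⟩
    · rw [hcard]
      exact Nat.not_odd_iff_even.1 hodd
    · exact fun e he ↦ hsub (hfin.mem_toFinset.1 he)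
    · intro h2 e he
      -- The degree in `H` is even, and not zero because isolated vertices of `H` have degree at
      -- least three in `G`.
      have heq : H.incidenceSet v = G.incidenceSet v := by
        refine Set.eq_of_subset_of_ncard_le hsub ?_ hfinG
        change G.vertexDegree v ≤ H.vertexDegree v
        rw [Nat.not_odd_iff_even] at hodd
        obtain ⟨r, hr⟩ := hodd
        omega
      rw [Set.Finite.mem_toFinset, heq]
      exact he
    · simp

lemma IsEUP.exists_connecting_pairs [G.Loopless] (hV : V(G).Finite) (hE : E(G).Finite)
    (hG : G.toSimpleGraph.Connected) (hcard : 3 ≤ E(G).ncard) (hH : G.IsEUP k H) :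
    ∃ P : Finset (Sym2 β), (∀ p ∈ P, p ∈ E(G.lineGraph) ∧ ∀ e ∈ p, ∃ v ∈ V(H), G.Inc e v) ∧
      {e | Odd (pairDegree P e)}.encard ≤ 2 ∧
      ∀ U : Set β, (∀ e f, s(e, f) ∈ P → e ∈ U → f ∈ U) →
        ∀ v ∈ V(H), ∀ e f, G.Inc e v → G.Inc f v → e ∈ U → f ∈ U := by
  classical
  have hle := hH.le
  have hVH : V(H).Finite := hV.subset hle.vertexSet_mono
  have hβ : Nonempty β := by
    obtain ⟨e, -⟩ := Set.nonempty_of_ncard_ne_zero (s := E(G)) (by omega)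
    exact ⟨e⟩
  have hex : ∀ v, ∃ (A : Finset β) (c : β), v ∈ V(H) → Even A.card ∧ (∀ e ∈ A, G.Inc e v) ∧
      (G.vertexDegree v = 2 → ∀ e, G.Inc e v → e ∈ A) ∧
      ∀ e, (v ∈ H.oddVertices → e ≠ c) → (e ∈ A ↔ H.Inc e v) := by
    intro v
    by_cases hv : v ∈ V(H)
    · obtain ⟨A, c, h⟩ := hH.exists_even_set hE hv
      exact ⟨A, c, fun _ ↦ h⟩
    · exact ⟨∅, hβ.some, fun h ↦ absurd h hv⟩
  choose A c hA using hex
  obtain ⟨P₀, hP₀, hodd₀, hforced₀⟩ := exists_pairs_of_even hVH.toFinset A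
    fun v hv ↦ (hA v (hVH.mem_toFinset.1 hv)).1
  simp only [Set.Finite.mem_toFinset] at hP₀ hodd₀ hforced₀
  have hKfin : {p | p ∈ E(G.lineGraph) ∧ ∀ e ∈ p, ∃ v ∈ V(H), G.Inc e v}.Finite :=
    (edgeSet_lineGraph_finite hE).subset fun p hp ↦ hp.1
  -- These pairs must survive the toggling of triangles: at a vertex of degree two they alone
  -- connect its two edges.
  let F : Set (Sym2 β) := {p | ∃ e f v, p = s(e, f) ∧ v ∈ V(H) ∧ e ≠ f ∧
    (∀ g, G.Inc g v ↔ g = e ∨ g = f) ∧ ∀ u, u ≠ v → ¬ (G.Inc e u ∧ G.Inc f u)}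
  obtain ⟨P, hPK, hFP, hodd, htri⟩ := exists_pairs_connecting_triangles hKfin.toFinset P₀ F
    (by
      intro p hp
      obtain ⟨v, hv, e, he, f, hf, hef, rfl⟩ := hP₀ p hp
      have he' := (hA v hv).2.1 e he
      have hf' := (hA v hv).2.1 f hf
      rw [Set.Finite.mem_toFinset]
      refine ⟨mk_mem_edgeSet_lineGraph.2 ⟨hef, v, he', hf'⟩, fun g hg ↦ ⟨v, hv, ?_⟩⟩
      rcases Sym2.mem_iff.1 hg with rfl | rfl
      exacts [he', hf'])
    (by
      rintro p ⟨e, f, v, rfl, hv, hef, hg, hu⟩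
      refine hforced₀ v hv e f hef (fun g ↦ ?_) fun u hu' huv h ↦
        hu u huv ⟨(hA u hu').2.1 e h.1, (hA u hu').2.1 f h.2⟩
      rw [← hg g]
      exact ⟨fun h ↦ (hA v hv).2.1 g h, fun h ↦ (hA v hv).2.2.1 (vertexDegree_eq_two hef hg) g h⟩)
  refine ⟨P, fun p hp ↦ hKfin.mem_toFinset.1 (hPK hp), ?_, ?_⟩
  · refine (Set.encard_le_encard ?_).trans ((Set.encard_image_le c H.oddVertices).trans
      hH.odd_le_two)
    intro e he
    rw [Set.mem_ofPred_eq, hodd, hodd₀] at he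
    by_contra hc
    -- An edge that was changed nowhere lies in the sets of its two ends if it belongs to `H`, and
    -- in none otherwise; both numbers are even.
    have hset : {v | v ∈ V(H) ∧ e ∈ A v} = {v | H.Inc e v} := by
      ext v
      constructor
      · rintro ⟨hv, hev⟩
        exact ((hA v hv).2.2.2 e fun ho h ↦ hc ⟨v, ho, h.symm⟩).1 hev
      · intro h
        exact ⟨Inc.vertex_mem h,
          ((hA v (Inc.vertex_mem h)).2.2.2 e fun ho h ↦ hc ⟨v, ho, h.symm⟩).2 h⟩
    rw [hset] at he
    obtain ⟨v, hv⟩ := Set.nonempty_of_ncard_ne_zero he.pos.ne'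
    obtain ⟨w, hvw⟩ := id hv
    have hpair : {v | H.Inc e v} = {v, w} := by
      ext u
      constructor
      · exact fun hu ↦ Inc.eq_or_eq_of_isLink hu hvw
      · rintro (rfl | rfl)
        exacts [hvw.inc_left, hvw.inc_right]
    rw [hpair, Set.ncard_pair (hvw.mono hle).ne] at he
    exact absurd he (by decide)
  · intro U hU
    have hthree : ∀ v ∈ V(H), 3 ≤ G.vertexDegree v → ∀ e f, G.Inc e v → G.Inc f v → e ∈ U →
        f ∈ U := by
      intro v hv h3 e f he hf heU
      by_cases hef : e = f
      · exact hef ▸ heU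
      obtain ⟨g, hg, hne⟩ : ∃ g, G.Inc g v ∧ g ∉ ({e, f} : Set β) :=
        Set.exists_mem_notMem_of_ncard_lt_ncard
          (s := {e, f}) (t := G.incidenceSet v) (by rw [Set.ncard_pair hef]; exact h3)
      rw [Set.mem_insert_iff, Set.mem_singleton_iff, not_or] at hne
      -- The only common end of a pair in `F` has degree two, so two edges meeting at `v` never form
      -- such a pair.
      have key : ∀ a b, G.Inc a v → G.Inc b v → a ≠ b →
          s(a, b) ∈ (hKfin.toFinset : Set (Sym2 β)) \ F := by
        intro a b ha hb hab
        refine ⟨?_, ?_⟩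
        · rw [Finset.mem_coe, Set.Finite.mem_toFinset]
          refine ⟨mk_mem_edgeSet_lineGraph.2 ⟨hab, v, ha, hb⟩, fun g hg ↦ ⟨v, hv, ?_⟩⟩
          rcases Sym2.mem_iff.1 hg with rfl | rfl
          exacts [ha, hb]
        · rintro ⟨x, y, u, hp, -, hxy, hu, huniq⟩
          have hxv : G.Inc x v ∧ G.Inc y v := by
            rcases Sym2.eq_iff.1 hp with ⟨rfl, rfl⟩ | ⟨rfl, rfl⟩
            exacts [⟨ha, hb⟩, ⟨hb, ha⟩]
          have hvu : v = u := by
            by_contra h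
            exact huniq v h hxv
          subst hvu
          have := vertexDegree_eq_two hxy hu
          omega
      exact htri e f g hef (Ne.symm hne.1) (Ne.symm hne.2) (key e f he hf hef)
        (key e g he hg (Ne.symm hne.1)) (key f g hf hg (Ne.symm hne.2)) U hU heU
    intro v hv e f he hf heU
    by_cases hef : e = f
    · exact hef ▸ heU
    by_cases h3 : 3 ≤ G.vertexDegree v
    · exact hthree v hv h3 e f he hf heU
    have h2 : G.vertexDegree v = 2 := by
      have := two_le_vertexDegree hE he hf hef
      omega
    have hv2 : ∀ g, G.Inc g v ↔ g = e ∨ g = f :=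
      fun g ↦ inc_iff_of_vertexDegree_eq_two hE h2 he hf hef
    by_cases hu : ∃ u, u ≠ v ∧ G.Inc e u ∧ G.Inc f u
    · obtain ⟨u, huv, heu, hfu⟩ := hu
      by_cases hu3 : 3 ≤ G.vertexDegree u
      · exact hthree u (hH.subset_vertexSet (mem_iUnion_verticesOfDegree.2 ⟨heu.vertex_mem, hu3⟩))
          hu3 e f heu hfu heU
      exfalso
      have hu2 : G.vertexDegree u = 2 := by
        have := two_le_vertexDegree hE heu hfu hef
        omega
      -- Two parallel edges whose ends both have degree two make up the whole connected graph, which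
      -- has at least three edges.
      have hsub : E(G) ⊆ {e, f} := by
        refine edgeSet_subset_of_connected hG he.edge_mem (Or.inl rfl) ?_
        intro g hg x hgx g' hg'
        have hgv : G.Inc g v := (hv2 g).2 hg
        have hgu : G.Inc g u := by
          rcases hg with rfl | rfl
          exacts [heu, hfu]
        rcases hgx.eq_or_eq_of_isLink (isLink_of_inc_of_inc hgv hgu huv.symm) with rfl | rfl
        · exact (hv2 g').1 hg'
        · exact (inc_iff_of_vertexDegree_eq_two hE hu2 heu hfu hef).1 hg'
      have := Set.ncard_le_ncard hsub (Set.toFinite _)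
      rw [Set.ncard_pair hef] at this
      omega
    · refine hU e f (hFP ⟨e, f, v, rfl, hv, hef, hv2, fun u huv h ↦ hu ⟨u, huv, h⟩⟩) heU

/-! ### Lifting branches of the line graph to the graph -/

/-- A path of the line graph with at least three vertices, consecutive vertices of which share an
end of degree two in `G`, together with the remaining ends of its first and last vertex. -/
structure LinePath (G : Graph α β) (b : G.lineGraph.NontrivialPath) where
  /-- The common end of the vertices `i` and `i + 1` of the path. -/
  w : ℕ → α
  /-- The remaining end of the first vertex of the path. -/
  first : α
  /-- The remaining end of the last vertex of the path. -/
  last : α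
  two_le : 2 ≤ b.length
  inc_iff : ∀ i < b.length, ∀ g, G.Inc g (w i) ↔ g = b.vert i ∨ g = b.vert (i + 1)
  link_first : G.IsLink (b.vert 0) first (w 0)
  link_last : G.IsLink (b.vert b.length) (w (b.length - 1)) last

namespace LinePath

variable {b : G.lineGraph.NontrivialPath} (c : G.LinePath b)
include c

lemma w_ne {i j : ℕ} (hij : i < j) (hj : j < b.length) : c.w i ≠ c.w j := by
  intro h
  have h1 := (c.inc_iff i (by omega) (b.vert i)).2 (Or.inl rfl)
  rw [h] at h1
  rcases (c.inc_iff j hj _).1 h1 with h2 | h2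
  · exact b.vert_ne (by omega) (by omega) (by omega) h2
  · exact b.vert_ne (by omega) (by omega) (by omega) h2

lemma w_inj {i j : ℕ} (hi : i < b.length) (hj : j < b.length) (h : c.w i = c.w j) : i = j := by
  rcases lt_trichotomy i j with hij | rfl | hij
  · exact absurd h (c.w_ne hij hj)
  · rfl
  · exact absurd h.symm (c.w_ne hij hi)

lemma vertexDegree_w {i : ℕ} (hi : i < b.length) : G.vertexDegree (c.w i) = 2 :=
  vertexDegree_eq_two (b.vert_ne (by omega) (by omega) (by omega)) (c.inc_iff i hi)

lemma link [G.Loopless] {i : ℕ} (hi : i + 1 < b.length) :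
    G.IsLink (b.vert (i + 1)) (c.w i) (c.w (i + 1)) :=
  isLink_of_inc_of_inc ((c.inc_iff i (by omega) _).2 (Or.inr rfl))
    ((c.inc_iff (i + 1) hi _).2 (Or.inl rfl)) (c.w_ne (by omega) hi)

lemma first_ne [G.Loopless] {i : ℕ} (hi : i < b.length) : c.first ≠ c.w i := by
  intro h
  rcases Nat.eq_zero_or_pos i with rfl | hpos
  · exact c.link_first.ne h
  · have h1 := c.link_first.inc_left
    rw [h, c.inc_iff i hi] at h1
    rcases h1 with h1 | h1
    · exact b.vert_ne (by omega) (by omega) (by omega) h1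
    · exact b.vert_ne (by omega) (by omega) (by omega) h1

lemma last_ne [G.Loopless] {i : ℕ} (hi : i < b.length) : c.last ≠ c.w i := by
  intro h
  by_cases hlast : i = b.length - 1
  · subst hlast
    exact c.link_last.ne h.symm
  · have h1 := c.link_last.inc_right
    rw [h, c.inc_iff i hi] at h1
    rcases h1 with h1 | h1
    · exact b.vert_ne (by omega) (by omega) (by omega) h1
    · exact b.vert_ne (by omega) (by omega) (by omega) h1

lemma not_inc_inner [G.Loopless] {i : ℕ} (hi : i + 1 < b.length) {x : α}
    (hx : ∀ j < b.length, x ≠ c.w j) : ¬ G.Inc (b.vert (i + 1)) x := fun h ↦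
  (h.eq_or_eq_of_isLink (c.link hi)).elim (hx i (by omega)) (hx (i + 1) hi)

lemma vertexDegree_first [G.Loopless] (hE : E(G).Finite) :
    G.lineGraph.vertexDegree (b.vert 0) = G.vertexDegree c.first := by
  have := c.two_le
  exact vertexDegree_lineGraph_eq hE c.link_first
    (c.not_inc_inner (i := 0) (by omega) fun j hj ↦ c.first_ne hj) (c.inc_iff 0 (by omega))

lemma vertexDegree_last [G.Loopless] (hE : E(G).Finite) :
    G.lineGraph.vertexDegree (b.vert b.length) = G.vertexDegree c.last := by
  have := c.two_le
  refine vertexDegree_lineGraph_eq hE c.link_last.symm (f := b.vert (b.length - 2 + 1))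
    (c.not_inc_inner (by omega) fun j hj ↦ c.last_ne hj) fun g ↦ ?_
  rw [c.inc_iff _ (by omega), or_comm, show b.length - 1 + 1 = b.length by omega,
    show b.length - 2 + 1 = b.length - 1 by omega]

/-- The path of `G` formed by the vertices of the given path of the line graph. -/
def toPath [G.Loopless] (h : c.first ≠ c.last) : G.NontrivialPath where
  length := b.length + 1
  length_pos := by omega
  vert i := if i = 0 then c.first else if i ≤ b.length then c.w (i - 1) else c.last
  edge := b.vert
  isLink i hi := by
    have := c.two_le
    rcases Nat.eq_zero_or_pos i with rfl | hpos
    · simpa [show 1 ≤ b.length by omega] using c.link_first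
    · rcases Nat.lt_succ_iff_lt_or_eq.1 hi with h | rfl
      · obtain ⟨j, rfl⟩ : ∃ j, i = j + 1 := ⟨i - 1, by omega⟩
        simpa [show j + 1 ≤ b.length by omega, show j + 1 + 1 ≤ b.length by omega]
          using c.link h
      · simpa [show b.length ≠ 0 by omega] using c.link_last
  injOn := by
    intro i hi j hj hij
    rw [Set.mem_Iic] at hi hj
    dsimp only at hij
    split_ifs at hij with h1 h2 h3 h4 h5 h6 h7 h8
    · omega
    · exact absurd hij (c.first_ne (by omega))
    · exact absurd hij h
    · exact absurd hij.symm (c.first_ne (by omega))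
    · have := c.w_inj (by omega) (by omega) hij
      omega
    · exact absurd hij.symm (c.last_ne (by omega))
    · exact absurd hij.symm h
    · exact absurd hij (c.last_ne (by omega))
    · omega

lemma isBranch_toPath [G.Loopless] (hE : E(G).Finite) (hb : b.IsBranch)
    (h : c.first ≠ c.last) : (c.toPath h).IsBranch := by
  have hlen : (c.toPath h).length = b.length + 1 := rfl
  refine ⟨?_, ?_, fun i hi hi' ↦ ?_⟩
  · have : (c.toPath h).vert 0 = c.first := rfl
    rw [this, ← c.vertexDegree_first hE]
    exact hb.1
  · have : (c.toPath h).vert (b.length + 1) = c.last := by simp [toPath]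
    rw [hlen, this, ← c.vertexDegree_last hE]
    exact hb.2.1
  · rw [hlen] at hi'
    have : (c.toPath h).vert i = c.w (i - 1) := by
      simp [toPath, hi.ne', Nat.lt_succ_iff.1 hi']
    rw [this]
    exact c.vertexDegree_w (by omega)

lemma isPendantBranch_toPath [G.Loopless] (hE : E(G).Finite) (hb : b.IsPendantBranch)
    (h : c.first ≠ c.last) : (c.toPath h).IsPendantBranch := by
  refine ⟨c.isBranch_toPath hE hb.1 h, ?_⟩
  obtain ⟨hb, e, ⟨i, hi, rfl⟩, -, hd⟩ := hb
  rw [Set.mem_Iic] at hi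
  by_cases h0 : i = 0
  · subst h0
    rw [c.vertexDegree_first hE] at hd
    exact ⟨c.first, ⟨0, Set.mem_Iic.2 (Nat.zero_le _), rfl⟩, c.link_first.left_mem, hd⟩
  · by_cases h1 : i = b.length
    · subst h1
      rw [c.vertexDegree_last hE] at hd
      exact ⟨c.last, ⟨b.length + 1, Set.mem_Iic.2 le_rfl, by simp [toPath]⟩,
        c.link_last.right_mem, hd⟩
    · have := hb.2.2 i (by omega) (by omega)
      omega

/-- If the ends of the path coincide, then its vertices form a cycle of `G`, which may be added. -/
lemma isEUP_add_cycle [G.Loopless] (hE : E(G).Finite) (hH : G.IsEUP k H) (hb : b.IsBranch)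
    (h : c.first = c.last) (hw : ∀ i < b.length, c.w i ∉ V(H)) :
    ∃ H₂, G.IsEUP k H₂ ∧ E(H) ⊂ E(H₂) := by
  have h2 := c.two_le
  have hF : ∀ i ≤ b.length, b.vert i ∈ E(G) := fun i hi ↦ vert_mem_vertexSet b hi
  have hlastInc : G.Inc (b.vert b.length) c.first := by
    rw [h]
    exact c.link_last.inc_right
  have h0l : b.vert 0 ≠ b.vert b.length := b.vert_ne (by omega) (by omega) (by omega)
  -- Two distinct edges meet here, and degree two is excluded because the vertex has the degree of
  -- an end of the branch `b`. Hence it lies in `H`, where the cycle can be attached.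
  have hd3 : 3 ≤ G.vertexDegree c.first := by
    have h1 := two_le_vertexDegree hE c.link_first.inc_left hlastInc h0l
    have h2 : G.vertexDegree c.first ≠ 2 := by
      rw [← c.vertexDegree_first hE]
      exact hb.1
    omega
  have ha : c.first ∈ V(H) :=
    hH.subset_vertexSet (mem_iUnion_verticesOfDegree.2 ⟨c.link_first.left_mem, hd3⟩)
  have hnotE : ∀ i ≤ b.length, b.vert i ∉ E(H) := by
    intro i hi he
    obtain ⟨j, hj, hinc⟩ : ∃ j < b.length, G.Inc (b.vert i) (c.w j) := by
      rcases hi.lt_or_eq with hi | rfl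
      · exact ⟨i, hi, (c.inc_iff i hi _).2 (Or.inl rfl)⟩
      · exact ⟨b.length - 1, by omega, c.link_last.inc_left⟩
    exact hw j hj (Inc.vertex_mem (hH.le.inc_iff.2 ⟨he, hinc⟩))
  have hFE : b.vertices ⊆ E(G) := by
    rintro _ ⟨i, hi, rfl⟩
    exact hF i hi
  have hends : ∀ i ≤ b.length, ∃ x y, G.IsLink (b.vert i) x y ∧
      (x = c.first ∨ x ∈ c.w '' Set.Iio b.length) ∧
      (y = c.first ∨ y ∈ c.w '' Set.Iio b.length) := by
    intro i hi
    rcases Nat.eq_zero_or_pos i with rfl | hpos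
    · exact ⟨_, _, c.link_first, Or.inl rfl, Or.inr ⟨0, Set.mem_Iio.2 (by omega), rfl⟩⟩
    · rcases hi.lt_or_eq with hi | rfl
      · obtain ⟨j, rfl⟩ : ∃ j, i = j + 1 := ⟨i - 1, by omega⟩
        exact ⟨_, _, c.link hi, Or.inr ⟨j, Set.mem_Iio.2 (by omega), rfl⟩,
          Or.inr ⟨j + 1, Set.mem_Iio.2 hi, rfl⟩⟩
      · exact ⟨_, _, c.link_last, Or.inr ⟨b.length - 1, Set.mem_Iio.2 (by omega), rfl⟩,
          Or.inl h.symm⟩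
  have hle := hH.le
  have hFH : Disjoint E(H) b.vertices := by
    rw [Set.disjoint_left]
    rintro _ he ⟨i, hi, rfl⟩
    exact hnotE i hi he
  have hFX : ∀ e ∈ b.vertices, ∀ x, G.Inc e x → x = c.first ∨ x ∈ c.w '' Set.Iio b.length := by
    rintro _ ⟨i, hi, rfl⟩ x hx
    obtain ⟨y, z, hyz, hy, hz⟩ := hends i hi
    rcases hx.eq_or_eq_of_isLink hyz with rfl | rfl
    exacts [hy, hz]
  refine ⟨_, hH.add_cycle hE (a := c.first) (X := c.w '' Set.Iio b.length) (F := b.vertices)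
    ha hFE hFH ?_ ?_ hFX ?_ ?_, ?_⟩
  · rintro _ ⟨i, hi, rfl⟩
    exact ⟨((c.inc_iff i hi _).2 (Or.inl rfl)).vertex_mem, c.vertexDegree_w hi⟩
  · rintro _ ⟨i, hi, rfl⟩ e he
    rw [Set.mem_Iio] at hi
    rcases (c.inc_iff i hi e).1 he with rfl | rfl
    · exact ⟨i, Set.mem_Iic.2 (by omega), rfl⟩
    · exact ⟨i + 1, Set.mem_Iic.2 (by omega), rfl⟩
  · have : {e | e ∈ b.vertices ∧ G.Inc e c.first} = {b.vert 0, b.vert b.length} := by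
      ext e
      constructor
      · rintro ⟨⟨i, hi, rfl⟩, he⟩
        rw [Set.mem_Iic] at hi
        rcases Nat.eq_zero_or_pos i with rfl | hpos
        · exact Or.inl rfl
        · rcases hi.lt_or_eq with hi | rfl
          · obtain ⟨j, rfl⟩ : ∃ j, i = j + 1 := ⟨i - 1, by omega⟩
            exact absurd he (c.not_inc_inner hi fun j hj ↦ c.first_ne hj)
          · exact Or.inr rfl
      · rintro (rfl | rfl)
        · exact ⟨⟨0, Set.mem_Iic.2 (by omega), rfl⟩, c.link_first.inc_left⟩
        · exact ⟨⟨b.length, Set.mem_Iic.2 le_rfl, rfl⟩, hlastInc⟩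
    rw [this, Set.ncard_pair h0l]
    exact even_two
  · intro U hU
    have hU' : ∀ i ≤ b.length, ∀ x y, G.IsLink (b.vert i) x y → (x ∈ U ↔ y ∈ U) := fun i hi x y hl ↦
      ⟨hU _ ⟨i, hi, rfl⟩ x y hl, hU _ ⟨i, hi, rfl⟩ y x hl.symm⟩
    have key : ∀ i < b.length, c.w i ∈ U ↔ c.first ∈ U := by
      intro i
      induction i with
      | zero => exact fun _ ↦ (hU' 0 (by omega) _ _ c.link_first).symm
      | succ i ih =>
        intro hi
        rw [← ih (by omega)]
        exact (hU' _ (by omega) _ _ (c.link hi)).symm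
    rintro _ ⟨i, hi, rfl⟩
    exact key i hi
  · rw [edgeSet_subgraphOf ?_ (Set.union_subset hle.edgeSet_mono hFE)]
    · refine ⟨Set.subset_union_left, fun hsub ↦ ?_⟩
      exact hnotE 0 (by omega) (hsub (Or.inr ⟨0, Set.mem_Iic.2 (by omega), rfl⟩))
    · rintro e (he | he) x hx
      · exact Or.inl (Inc.vertex_mem (hle.inc_iff.2 ⟨he, hx⟩))
      · rcases hFX e he x hx with rfl | h
        exacts [Or.inl ha, Or.inr h]

end LinePath

/-- The subgraph consists of all edges of `G` meeting `V(H)`, with the connecting pairs as its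
edges. Maximality serves only to exclude branches of the line graph that close up to a cycle of `G`.
-/
theorem IsEUP.exists_lineGraph_of_maximal [G.Loopless] (hV : V(G).Finite) (hE : E(G).Finite)
    (hG : G.toSimpleGraph.Connected) (hk : 1 ≤ k) (hcard : 3 ≤ E(G).ncard)
    (hH : G.IsEUP (k + 1) H) (hmax : ∀ H₂, G.IsEUP (k + 1) H₂ → ¬ E(H) ⊂ E(H₂)) :
    ∃ H', G.lineGraph.IsEUP k H' := by
  classical
  obtain ⟨P, hP, hodd, hconn⟩ := hH.exists_connecting_pairs hV hE hG hcard
  have hle := hH.le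
  have hEH : E(H).Finite := hE.subset hle.edgeSet_mono
  let S : Set β := {e | ∃ v ∈ V(H), G.Inc e v}
  have hPS : ∀ p ∈ (P : Set (Sym2 β)), ∀ e, G.lineGraph.Inc p e → e ∈ S := fun p hp e he ↦
    (hP p hp).2 e (lineGraph_inc_iff.1 he).2
  have hPE : (P : Set (Sym2 β)) ⊆ E(G.lineGraph) := fun p hp ↦ (hP p hp).1
  have hSE : S ⊆ V(G.lineGraph) := fun e ⟨v, _, he⟩ ↦ he.edge_mem
  have hle' : G.lineGraph.subgraphOf S P ≤ G.lineGraph := subgraphOf_le hSE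
  have hE' : E(G.lineGraph.subgraphOf S P) = P := edgeSet_subgraphOf hPS hPE
  have hdeg : ∀ e, (G.lineGraph.subgraphOf S P).vertexDegree e = pairDegree P e :=
    vertexDegree_eq_pairDegree hle' hE'
  have hlink : ∀ {e f}, s(e, f) ∈ P → (G.lineGraph.subgraphOf S P).IsLink s(e, f) e f := by
    intro e f h
    exact (subgraphOf_isLink hPS).2 ⟨h, lineGraph_isLink_iff.2 ⟨rfl, hPE h⟩⟩
  -- an edge of `G` lying in no pair is the only edge at its ends in `H`
  have hisol : ∀ e, (∀ f, s(e, f) ∉ P) → ∀ v ∈ V(H), G.Inc e v → ∀ f, G.Inc f v → f = e := by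
    intro e he v hv hev f hfv
    refine hconn {e} ?_ v hv e f hev hfv rfl
    rintro x y hxy rfl
    exact absurd hxy (he y)
  have hbranch : ∀ b : G.lineGraph.NontrivialPath, b.IsBranch →
      Disjoint b.edges E(G.lineGraph.subgraphOf S P) → 2 ≤ b.length →
      ∃ (c : G.LinePath b) (h : c.first ≠ c.last), Disjoint (c.toPath h).edges E(H) := by
    intro b hb hdis h2
    rw [hE'] at hdis
    have hedge : ∀ i < b.length, s(b.vert i, b.vert (i + 1)) ∉ P := by
      intro i hi hp
      refine Set.disjoint_left.1 hdis ⟨i, hi, rfl⟩ ?_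
      rw [(lineGraph_isLink_iff.1 (b.isLink i hi)).1]
      exact hp
    have hcommon : ∀ i, ∃ v, i < b.length → G.Inc (b.vert i) v ∧ G.Inc (b.vert (i + 1)) v := by
      intro i
      by_cases hi : i < b.length
      · obtain ⟨-, -, v, hv⟩ := b.isLink i hi
        exact ⟨v, fun _ ↦ hv⟩
      · exact ⟨(hG.nonempty.some : V(G)), fun h ↦ absurd h hi⟩
    choose w hw using hcommon
    -- An inner vertex of the branch has degree two in the line graph, so its only neighbours are
    -- those along the branch, and these pairs avoid `P`.
    have hinner : ∀ i, 0 < i → i < b.length → ∀ f, s(b.vert i, f) ∉ P := by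
      intro i hi hi' f hf
      obtain ⟨j, rfl⟩ : ∃ j, i = j + 1 := ⟨i - 1, by omega⟩
      have hn : G.lineNeighbors (b.vert (j + 1)) = {b.vert j, b.vert (j + 2)} := by
        refine (Set.eq_of_subset_of_ncard_le ?_ ?_ (lineNeighbors_finite hE _)).symm
        · rintro _ (rfl | rfl)
          · exact ⟨b.vert_ne (by omega) (by omega) (by omega), w j, (hw j (by omega)).2,
              (hw j (by omega)).1⟩
          · exact ⟨b.vert_ne (by omega) (by omega) (by omega), w (j + 1), hw (j + 1) hi'⟩
        · rw [Set.ncard_pair (b.vert_ne (by omega) (by omega) (by omega)),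
            ← vertexDegree_lineGraph, hb.2.2 _ hi hi']
      have hfn : f ∈ G.lineNeighbors (b.vert (j + 1)) := mem_lineNeighbors.2 (hPE hf)
      rw [hn] at hfn
      rcases hfn with rfl | rfl
      · rw [Sym2.eq_swap] at hf
        exact hedge j (by omega) hf
      · exact hedge (j + 1) hi' hf
    -- As the branch has at least two edges, one of the two edges of `G` meeting at `w i` is an
    -- inner vertex of it. By `hisol` that edge would be alone at `w i` if `w i` were in `H`.
    have hwH : ∀ i < b.length, w i ∉ V(H) := by
      intro i hi hwi
      have hne : b.vert i ≠ b.vert (i + 1) := b.vert_ne (by omega) (by omega) (by omega)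
      rcases Nat.eq_zero_or_pos i with rfl | hpos
      · exact hne (hisol _ (hinner 1 (by omega) (by omega)) _ hwi (hw 0 hi).2 _ (hw 0 hi).1)
      · exact hne (hisol _ (hinner i hpos hi) _ hwi (hw i hi).1 _ (hw i hi).2).symm
    have hw2 : ∀ i < b.length, ∀ g, G.Inc g (w i) ↔ g = b.vert i ∨ g = b.vert (i + 1) := by
      intro i hi g
      have hne : b.vert i ≠ b.vert (i + 1) := b.vert_ne (by omega) (by omega) (by omega)
      refine inc_iff_of_vertexDegree_eq_two hE ?_ (hw i hi).1 (hw i hi).2 hne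
      have h1 := two_le_vertexDegree hE (hw i hi).1 (hw i hi).2 hne
      have h2 : ¬ 3 ≤ G.vertexDegree (w i) := fun h ↦ hwH i hi
        (hH.subset_vertexSet (mem_iUnion_verticesOfDegree.2 ⟨(hw i hi).1.vertex_mem, h⟩))
      omega
    obtain ⟨a, ha⟩ := (hw 0 (by omega)).1
    have hlast := (hw (b.length - 1) (by omega)).2
    rw [Nat.sub_add_cancel b.length_pos] at hlast
    obtain ⟨z, hz⟩ := hlast
    let c : G.LinePath b := ⟨w, a, z, h2, hw2, ha.symm, hz⟩
    have hcl : c.first ≠ c.last := by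
      intro h
      obtain ⟨H₂, hH₂, hlt⟩ := c.isEUP_add_cycle hE hH hb h hwH
      exact hmax H₂ hH₂ hlt
    refine ⟨c, hcl, ?_⟩
    rw [Set.disjoint_left]
    rintro _ ⟨i, hi, rfl⟩ he
    have hi : i < b.length + 1 := hi
    have he : b.vert i ∈ E(H) := he
    obtain ⟨j, hj, hinc⟩ : ∃ j < b.length, G.Inc (b.vert i) (w j) := by
      rcases Nat.lt_succ_iff_lt_or_eq.1 hi with hi | rfl
      · exact ⟨i, hi, (hw i hi).1⟩
      · exact ⟨b.length - 1, by omega, hz.inc_left⟩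
    exact hwH j hj (Inc.vertex_mem (hle.inc_iff.2 ⟨he, hinc⟩))
  have hlen : ∀ {b : G.lineGraph.NontrivialPath} (c : G.LinePath b) (h : c.first ≠ c.last),
      (c.toPath h).edges.encard = ((b.length + 1 : ℕ) : ℕ∞) := fun c h ↦
    (c.toPath h).encard_edges
  refine ⟨G.lineGraph.subgraphOf S P, hle', ?_, ?_, ?_, ?_, ?_, ?_⟩
  · refine (Set.encard_le_encard ?_).trans hodd
    rintro e ⟨-, he⟩
    rwa [hdeg] at he
  · rintro e ⟨⟨v, hv, hev⟩, h0⟩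
    rw [hdeg] at h0
    have he : ∀ f, s(e, f) ∉ P := fun f hf ↦
      (pairDegree_pos.2 ⟨_, hf, Sym2.mem_mk_left e f⟩).ne' h0
    exfalso
    -- If `e` were not in `H`, then `v` would be isolated in `H`, hence of degree at least three in
    -- `G`, although `e` is the only edge there.
    have heH : H.Inc e v := by
      by_contra hne
      have hv0 : H.vertexDegree v = 0 := by
        by_contra h
        obtain ⟨f, hf⟩ := (vertexDegree_ne_zero_iff hEH).1 h
        have := hisol e he v hv hev f (hf.mono hle)
        exact hne (this ▸ hf)
      have h3 := (mem_iUnion_verticesOfDegree.1 (hH.isolated_subset ⟨hv, hv0⟩)).2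
      have h1 : G.incidenceSet v ⊆ {e} := fun f hf ↦ hisol e he v hv hev f hf
      have := Set.ncard_le_ncard h1 (Set.toFinite _)
      rw [Set.ncard_singleton] at this
      rw [vertexDegree] at h3
      omega
    -- Both ends of `e` now lie in `H`, and `e` is the only edge at each.
    have hsub : E(G) ⊆ {e} := by
      refine edgeSet_subset_of_connected hG hev.edge_mem rfl ?_
      rintro f rfl x hx g hg
      exact hisol f he x (Inc.vertex_mem (hle.inc_iff.2 ⟨heH.edge_mem, hx⟩)) hx g hg
    have := Set.ncard_le_ncard hsub (Set.toFinite _)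
    rw [Set.ncard_singleton] at this
    omega
  · intro e he
    obtain ⟨heE, hd⟩ := mem_iUnion_verticesOfDegree.1 he
    obtain ⟨x, hx, hd'⟩ := exists_three_le_vertexDegree hE heE hd
    exact ⟨x, hH.subset_vertexSet (mem_iUnion_verticesOfDegree.2 ⟨hx.vertex_mem, hd'⟩), hx⟩
  · refine componentsWithinDist_iff.1 ?_
    intro U hUS hU hne hne'
    rw [vertexSet_subgraphOf] at hUS hne' ⊢
    have hU' := hconn U fun e f h ↦ hU _ e f (hlink h)
    obtain ⟨x, ⟨hxH, e, heU, hex⟩, y, hy, hyU, hd⟩ := hH.componentsWithinDist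
      {v | v ∈ V(H) ∧ ∃ e ∈ U, G.Inc e v} (fun v hv ↦ hv.1)
      (by
        rintro e x y hxy ⟨hx, f, hf, hfx⟩
        exact ⟨hxy.right_mem, e, hU' x hx f e hfx (hxy.mono hle).inc_left hf,
          (hxy.mono hle).inc_right⟩)
      (by
        obtain ⟨e, he⟩ := hne
        obtain ⟨v, hv, hev⟩ := hUS he
        exact ⟨v, hv, e, he, hev⟩)
      (by
        intro h
        refine hne' (hUS.antisymm ?_)
        rintro f ⟨v, hv, hfv⟩
        rw [← h] at hv
        obtain ⟨hv, e, he, hev⟩ := hv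
        exact hU' v hv e f hev hfv he)
    rw [Nat.add_sub_cancel] at hd
    have hxy : x ≠ y := by
      rintro rfl
      exact hyU ⟨hxH, e, heU, hex⟩
    -- Distance `k` in `G` becomes `k - 1` between suitable edges at `x` and `y`. Which edges occur
    -- does not matter, since `U` contains all or none of the edges at a vertex of `H`.
    obtain ⟨j, rfl⟩ : ∃ j, k = j + 1 := ⟨k - 1, by omega⟩
    obtain ⟨e', f, he', hf, hd'⟩ := hd.exists_lineGraph hxy
    exact ⟨e', hU' x hxH e e' hex he' heU, f, ⟨y, hy, hf⟩, fun h ↦ hyU ⟨hy, f, h, hf⟩, hd'⟩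
  · intro b hb hdis
    rw [NontrivialPath.encard_edges]
    by_cases h2 : 2 ≤ b.length
    · obtain ⟨c, h, hdis'⟩ := hbranch b hb hdis h2
      have := hH.branch_le _ (c.isBranch_toPath hE hb h) hdis'
      rw [hlen c h] at this
      norm_cast at this ⊢
      omega
    · norm_cast
      omega
  · intro b hb hdis
    rw [NontrivialPath.encard_edges]
    by_cases h2 : 2 ≤ b.length
    · obtain ⟨c, h, hdis'⟩ := hbranch b hb.1 hdis h2
      have := hH.pendant_le _ (c.isPendantBranch_toPath hE hb h) hdis'
      rw [hlen c h] at this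
      norm_cast at this ⊢
      omega
    · norm_cast
      omega

theorem IsEUP.exists_lineGraph [G.Loopless] (hV : V(G).Finite) (hE : E(G).Finite)
    (hG : G.toSimpleGraph.Connected) (hk : 1 ≤ k) (hH : G.IsEUP (k + 1) H) :
    ∃ H', G.lineGraph.IsEUP k H' := by
  by_cases hcard : E(G).ncard ≤ 2
  · exact ⟨⊥, isEUP_bot_lineGraph hE hcard hk⟩
  -- Maximality concerns edge sets only, and there are finitely many of these.
  have hfin : {F | ∃ H₁, G.IsEUP (k + 1) H₁ ∧ E(H₁) = F}.Finite := by
    refine hE.finite_subsets.subset ?_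
    rintro _ ⟨H₁, hH₁, rfl⟩
    exact hH₁.le.edgeSet_mono
  obtain ⟨F, hF⟩ := hfin.exists_maximal ⟨_, H, hH, rfl⟩
  obtain ⟨⟨H₁, hH₁, rfl⟩, hmax⟩ := hF
  exact hH₁.exists_lineGraph_of_maximal hV hE hG hk (by omega) fun H₂ hH₂ hlt ↦
    hlt.2 (hmax ⟨H₂, hH₂, rfl⟩ hlt.1)

end Graph

theorem theorem3p1 {α β : Type*} (G : Graph α β) [G.Loopless]
    (hV : V(G).Finite) (hE : E(G).Finite) (hG : G.toSimpleGraph.Connected)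
    (k : ℕ) (hk : 1 ≤ k) :
    (G.lineGraph.EUP k).Nonempty ↔ (G.EUP (k + 1)).Nonempty :=
  ⟨fun ⟨_, hH'⟩ ↦ Graph.IsEUP.exists_of_lineGraph hE hG hk hH',
    fun ⟨_, hH⟩ ↦ Graph.IsEUP.exists_lineGraph hV hE hG hk hH⟩
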